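/- Let $\Omega=Y=(0,1)$, $0<\alpha<\beta$, $\lambda\in(0,1)$, and let $a_\lambda$ be the $1$-periodic function on $\mathbb{R}$ with $a_\lambda=\alpha$ on $[0,\frac{\lambda}{2})\cup[1-\frac{\lambda}{2},1)$ and $a_\lambda=\beta$ on $[\frac{\lambda}{2},1-\frac{\lambda}{2})$. Let $f(z)=0$ for $z\in\{-1,1\}$, $f(0)=1$, and $f(z)=+\infty$ otherwise. For $\varepsilon>0$ and $u\in L^1(\Omega)$ put $$F^\lambda_\varepsilon(u)=\int_{\Omega\times\Omega}a_\lambda\Big(\frac{x-y}{\varepsilon}\Big)f(u(x)-u(y))\,dx\,dy\in[0,+\infty].$$ For measurable $\varphi:Y\to[0,1]$ put $$F^\lambda(\varphi)=\int_Y\int_Y a_\lambda(\sigma-\tau)\big[\varphi(\sigma)\varphi(\tau)+(1-\varphi(\sigma))(1-\varphi(\tau))\big]\,d\sigma\,d\tau,$$ let $\gamma_\lambda(t)=\inf\{F^\lambda(\varphi):\varphi\in L^\infty(Y;[0,1]),\ \int_Y\varphi=t\}$ for $t\in[0,1]$, and let $$\overline F^\lambda(u)=\inf\Big\{\gamma_\lambda(t):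 t\in\Big[\int_\Omega u-\operatorname{ess\,inf}u,\ \int_\Omega u-\operatorname{ess\,sup}u+1\Big]\Big\},\qquad \inf\emptyset=+\infty .$$ Let $\varphi_{1/2}$ be the $1$-periodic extension of the indicator function of $[0,\frac14)\cup(\frac34,1)$. Theorem. For every constant function $u\equiv c\in\mathbb{R}$, the $\Gamma$-limit of $F^\lambda_\varepsilon$ as $\varepsilon\to0^+$ with respect to the weak topology of $L^1(\Omega)$ exists at $c$ (both in the topological sense and in the sequential sense along every sequence $\varepsilon_k\to0^+$), and $$\Big(\Gamma\text{-}\lim_{\varepsilon\to0}F^\lambda_\varepsilon\Big)(c)=\overline F^\lambda(c)=\gamma_\lambda(1/2)=\frac{\bigl(1-(1-\lambda)^2\bigr)\alpha+(1-\lambda)^2\beta}{2}.$$ The infimum defining $\overline F^\lambda(c)$ is attained at $t=\frac12$, and the infimum defining $\gamma_\lambda(1/2)$ is attained at $\varphi_{1/2}$. Moreover $u_\varepsilon^*(x)=c-\frac12+\varphi_{1/2}(x/\varepsilon)$ is a recovery family: $u^*_\varepsilon\rightharpoonup c$ weakly in $L^1(\Omega)$ and $F^\lambda_\varepsilon(u^*_\varepsilon)\to\overline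 F^\lambda(c)$ as $\varepsilon\to0^+$. -/

import Mathlib

open MeasureTheory Filter Topology Set
open scoped ENNReal

/-- Lebesgue measure on the domain `Ω = (0,1)` (which is also the unit cell `Y = (0,1)`). -/
noncomputable abbrev unitMeasure : Measure ℝ := volume.restrict (Ioo (0 : ℝ) 1)

/-- The Banach space `L¹(Ω)`. -/
abbrev LOne : Type := Lp ℝ 1 unitMeasure

/-- `L¹(Ω)` endowed with its weak topology. -/
abbrev WeakLOne : Type := WeakSpace ℝ LOne

/-- The triple-well potential: `0` at `±1`, `1` at `0`, and `+∞` elsewhere. -/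
noncomputable def tripleWell (z : ℝ) : ℝ≥0∞ :=
  if z = 1 ∨ z = -1 then 0 else if z = 0 then 1 else ⊤

/-- The `1`-periodic weight: `α` on `[0, lam/2) ∪ [1 - lam/2, 1)`, `β` on `[lam/2, 1 - lam/2)`. -/
noncomputable def bandWeight (α β lam t : ℝ) : ℝ :=
  if Int.fract t < lam / 2 ∨ 1 - lam / 2 ≤ Int.fract t then α else β

/-- The non-local energy
`∫_{Ω×Ω} a_lam((x-y)/ε) f(u(x)-u(y)) dx dy`, with values in `[0,+∞]`. -/
noncomputable def nonlocalEnergy (α β lam ε : ℝ) (u : LOne) : ℝ≥0∞ :=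
  ∫⁻ p : ℝ × ℝ, ENNReal.ofReal (bandWeight α β lam ((p.1 - p.2) / ε)) *
    tripleWell (u p.1 - u p.2) ∂(unitMeasure.prod unitMeasure)

/-- The same energy, as a functional on `L¹(Ω)` with the weak topology. -/
noncomputable def weakEnergy (α β lam ε : ℝ) (u : WeakLOne) : ℝ≥0∞ :=
  nonlocalEnergy α β lam ε ((toWeakSpace ℝ LOne).symm u)

section GammaConvergence

variable {ι X : Type*} [TopologicalSpace X]

/-- The topological `Γ`-lower limit at `x` of the functionals `F i` along the filter `l`. -/
noncomputable def gammaLiminf (l : Filter ι) (F : ι → X → ℝ≥0∞) (x : X) : ℝ≥0∞ :=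
  ⨆ U ∈ 𝓝 x, liminf (fun i => ⨅ u ∈ U, F i u) l

/-- The topological `Γ`-upper limit at `x` of the functionals `F i` along the filter `l`. -/
noncomputable def gammaLimsup (l : Filter ι) (F : ι → X → ℝ≥0∞) (x : X) : ℝ≥0∞ :=
  ⨆ U ∈ 𝓝 x, limsup (fun i => ⨅ u ∈ U, F i u) l

/-- The `Γ`-limit of `F i` along `l` exists at `x` and equals `L` (topological definition). -/
def IsGammaLimitAt (l : Filter ι) (F : ι → X → ℝ≥0∞) (x : X) (L : ℝ≥0∞) : Prop :=
  gammaLiminf l F x = L ∧ gammaLimsup l F x = L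

/-- The `Γ`-limit of `F ε` as `ε → 0⁺` exists at `x` and equals `L` (sequential definition): for
every sequence `e k → 0⁺` the liminf inequality holds for all sequences converging to `x`, and
some sequence converging to `x` satisfies the limsup inequality. -/
def IsSeqGammaLimitAt (F : ℝ → X → ℝ≥0∞) (x : X) (L : ℝ≥0∞) : Prop :=
  ∀ e : ℕ → ℝ, Tendsto e atTop (𝓝[>] 0) →
    (∀ u : ℕ → X, Tendsto u atTop (𝓝 x) → L ≤ liminf (fun k => F (e k) (u k)) atTop) ∧
    ∃ u : ℕ → X, Tendsto u atTop (𝓝 x) ∧ limsup (fun k => F (e k) (u k)) atTop ≤ L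

end GammaConvergence

/-- The cell functional
`∫_Y ∫_Y a_lam(σ-τ) [φ(σ)φ(τ) + (1-φ(σ))(1-φ(τ))] dσ dτ`. -/
noncomputable def cellEnergy (α β lam : ℝ) (φ : ℝ → ℝ) : ℝ :=
  ∫ σ in Ioo (0 : ℝ) 1, ∫ τ in Ioo (0 : ℝ) 1,
    bandWeight α β lam (σ - τ) * (φ σ * φ τ + (1 - φ σ) * (1 - φ τ))

/-- The admissible profiles of volume fraction `t`: `φ ∈ L^∞(Y;[0,1])` with `∫_Y φ = t`. -/
def cellProfiles (t : ℝ) : Set (ℝ → ℝ) :=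
  {φ | AEMeasurable φ unitMeasure ∧ (∀ᵐ σ ∂unitMeasure, φ σ ∈ Icc (0 : ℝ) 1) ∧
    ∫ σ in Ioo (0 : ℝ) 1, φ σ = t}

/-- The value `γ_lam(t)` of the cell problem: the infimum of the (nonnegative) cell functional over
the admissible profiles of volume fraction `t`. -/
noncomputable def cellValue (α β lam t : ℝ) : ℝ≥0∞ :=
  ⨅ φ ∈ cellProfiles t, ENNReal.ofReal (cellEnergy α β lam φ)

/-- The `1`-periodic profile `φ_t`, the indicator of `[0, t/2) ∪ (1 - t/2, 1)` modulo `1`. -/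
noncomputable def bandProfile (t x : ℝ) : ℝ :=
  if Int.fract x < t / 2 ∨ 1 - t / 2 < Int.fract x then 1 else 0

/-- The set `I_u = [∫_Ω u - ess inf u, ∫_Ω u - ess sup u + 1]` of admissible volume fractions; the
essential bounds are taken in `[-∞,+∞]`, so the set is empty if `u` is essentially unbounded. -/
noncomputable def fractionSet (u : LOne) : Set ℝ :=
  {t | ((∫ x, u x ∂unitMeasure : ℝ) : EReal) - essInf (fun x => ((u x : ℝ) : EReal)) unitMeasure
      ≤ (t : EReal) ∧
    (t : EReal) ≤ ((∫ x, u x ∂unitMeasure : ℝ) : EReal)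
      - essSup (fun x => ((u x : ℝ) : EReal)) unitMeasure + 1}

/-- The homogenized functional: the infimum of `γ_lam(t)` over `t ∈ I_u` (`+∞` if `I_u` is empty). -/
noncomputable def homEnergy (α β lam : ℝ) (u : LOne) : ℝ≥0∞ :=
  ⨅ t ∈ fractionSet u, cellValue α β lam t

/-- The constant function `c` as an element of `L¹(Ω)`. -/
noncomputable def constLOne (c : ℝ) : LOne := Lp.const 1 unitMeasure c

theorem measurable_bandProfile (t : ℝ) : Measurable (bandProfile t) := by
  unfold bandProfile
  refine Measurable.ite ?_ measurable_const measurable_const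
  exact (measurableSet_lt measurable_fract measurable_const).union
    (measurableSet_lt measurable_const measurable_fract)

theorem memLp_oscillation (c ε : ℝ) :
    MemLp (fun x => c - 1 / 2 + bandProfile (1 / 2) (x / ε)) 1 unitMeasure := by
  refine MemLp.of_bound (C := |c - 1 / 2| + 1) ?_ ?_
  · exact (((measurable_bandProfile (1 / 2)).comp
      (measurable_id.div_const ε)).const_add (c - 1 / 2)).aestronglyMeasurable
  · refine Eventually.of_forall fun x => (norm_add_le _ _).trans ?_
    have h : ‖bandProfile (1 / 2) (x / ε)‖ ≤ 1 := by
      unfold bandProfile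
      split_ifs <;> simp
    simpa [Real.norm_eq_abs] using h

/-- The oscillating function `x ↦ c - 1/2 + φ_{1/2}(x/ε)` as an element of `L¹(Ω)`. -/
noncomputable def oscillatingLOne (c ε : ℝ) : LOne := (memLp_oscillation c ε).toLp _

/-! The energy has a lower bound that does not depend on `u`, so the liminf inequality needs no
compactness, and the oscillating family reaches the bound.

If `u` has finite energy, its values lie a.e. in a translate `v + {-1, 0, 1}`. The spin `ψ = cos (π
(v - u))` is then `±1`, and the potential at `u x - u y` is at least `(1 + ψ x ψ y) / 2`. This is
quadratic in `ψ` and the weight is `ε`-periodic, so the energy of `N × N` periods is exactly `(ε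
N)²` times the cell energy of the average of `ψ` over the periods (`integral_spinDensity_fold`).
With `N = ⌊1/ε⌋` the factor tends to `1`, and a bound on the cell energy of every periodic profile
with `|ψ| ≤ 1` and arbitrary mean `s` remains to be found.

By `spinEnergy_eq`, that bound amounts to `∫ ψ P ≤ l (1 - l) + s²`, where `P` integrates `ψ` over a
centred window of length `l` (`integral_mul_window_le`). If `|s|` is large, this follows by
comparing `1 - ψ` on a window and on a whole period. If `|s|` is small, it follows from `∫ |P| ≤ l
(1 - l)` (`integral_abs_window_le_mul`), with the complementary window when `l > 1/2`. That `L¹`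
bound is geometric: `P` is `2`-Lipschitz and `|P| ≤ l`, so between two zeros `|P|` lies below a
trapezoid, and the cases are sorted by the position of the zeros on the circle.

The square wave gives equality. It also converges weakly to its mean, because a shift by half a
period changes its sign. -/

/-- A function below the trapezoid of height `κ` with sides of slope `±2` over `[a, b]`. -/
theorem integral_le_trapezoid {q : ℝ → ℝ} (hq : Continuous q) {a b κ : ℝ} (hκ : 0 ≤ κ)
    (hκab : κ ≤ b - a) (h1 : ∀ x ∈ Icc a b, q x ≤ κ) (h2 : ∀ x ∈ Icc a b, q x ≤ 2 * (x - a))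
    (h3 : ∀ x ∈ Icc a b, q x ≤ 2 * (b - x)) :
    ∫ x in a..b, q x ≤ κ * (b - a) - κ ^ 2 / 2 := by
  have hI : ∀ u v, IntervalIntegrable q volume u v := fun u v => hq.intervalIntegrable u v
  -- Sides of slope `±2` reach height `κ` at distance `κ / 2` from the ends; `κ ≤ b - a` leaves room
  -- for both.
  have e1 : ∫ x in a..(a + κ / 2), q x ≤ ∫ x in a..(a + κ / 2), 2 * (x - a) :=
    intervalIntegral.integral_mono_on (by linarith) (hI _ _)
      ((by fun_prop : Continuous fun x : ℝ => 2 * (x - a)).intervalIntegrable _ _)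
      fun x hx => h2 x ⟨hx.1, by linarith [hx.2]⟩
  have e2 : ∫ x in (a + κ / 2)..(b - κ / 2), q x ≤ ∫ _ in (a + κ / 2)..(b - κ / 2), κ :=
    intervalIntegral.integral_mono_on (by linarith) (hI _ _)
      (continuous_const.intervalIntegrable _ _)
      fun x hx => h1 x ⟨by linarith [hx.1], by linarith [hx.2]⟩
  have e3 : ∫ x in (b - κ / 2)..b, q x ≤ ∫ x in (b - κ / 2)..b, 2 * (b - x) :=
    intervalIntegral.integral_mono_on (by linarith) (hI _ _)
      ((by fun_prop : Continuous fun x : ℝ => 2 * (b - x)).intervalIntegrable _ _)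
      fun x hx => h3 x ⟨by linarith [hx.1], hx.2⟩
  have f1 : ∫ x in a..(a + κ / 2), 2 * (x - a) = κ ^ 2 / 4 := by
    rw [intervalIntegral.integral_const_mul, intervalIntegral.integral_sub (by simp) (by simp)]
    simp only [integral_id, intervalIntegral.integral_const, smul_eq_mul]
    ring
  have f3 : ∫ x in (b - κ / 2)..b, 2 * (b - x) = κ ^ 2 / 4 := by
    rw [intervalIntegral.integral_const_mul, intervalIntegral.integral_sub (by simp) (by simp)]
    simp only [integral_id, intervalIntegral.integral_const, smul_eq_mul]
    ring
  have f2 : ∫ _ in (a + κ / 2)..(b - κ / 2), κ = κ * (b - a - κ) := by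
    simp only [intervalIntegral.integral_const, smul_eq_mul]
    ring
  have := intervalIntegral.integral_add_adjacent_intervals (hI a (a + κ / 2))
    (hI (a + κ / 2) (b - κ / 2))
  have := intervalIntegral.integral_add_adjacent_intervals (hI a (b - κ / 2)) (hI (b - κ / 2) b)
  nlinarith

/-! ### Sharp `L¹` bound for window increments of a `1`-Lipschitz function. -/

section WindowIncrement

variable {Ψ : ℝ → ℝ} {s l : ℝ}

theorem abs_increment_le (hL : LipschitzWith 1 Ψ) (x y : ℝ) : |Ψ x - Ψ y| ≤ |x - y| := by
  have := hL.dist_le_mul x y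
  simpa [Real.dist_eq] using this

theorem continuous_window (hL : LipschitzWith 1 Ψ) (l : ℝ) :
    Continuous fun x => Ψ (x + l) - Ψ x :=
  (hL.continuous.comp (continuous_id.add continuous_const)).sub hL.continuous

theorem abs_window_le (hL : LipschitzWith 1 Ψ) (hl : 0 ≤ l) (x : ℝ) :
    |Ψ (x + l) - Ψ x| ≤ l := by
  have := abs_increment_le hL (x + l) x
  rwa [add_sub_cancel_left, abs_of_nonneg hl] at this

/-- The increment is a difference of two `1`-Lipschitz functions, hence `2`-Lipschitz. -/
theorem abs_window_le_of_zero (hL : LipschitzWith 1 Ψ) {z : ℝ} (hz : Ψ (z + l) - Ψ z = 0)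
    (x : ℝ) : |Ψ (x + l) - Ψ x| ≤ 2 * |x - z| := by
  have h1 := abs_increment_le hL (x + l) (z + l)
  have h2 := abs_increment_le hL x z
  rw [add_sub_add_right_eq_sub] at h1
  rw [abs_le] at *
  constructor <;> linarith [h1.1, h1.2, h2.1, h2.2]

theorem window_periodic (hs : ∀ x, Ψ (x + 1) = Ψ x + s) :
    Function.Periodic (fun x => Ψ (x + l) - Ψ x) 1 := by
  intro x
  have := hs (x + l)
  have := hs x
  have e : x + 1 + l = x + l + 1 := by ring
  simp only [e]
  linarith

theorem integral_window (hL : LipschitzWith 1 Ψ) (hs : ∀ x, Ψ (x + 1) = Ψ x + s) :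
    ∫ x in (0 : ℝ)..1, (Ψ (x + l) - Ψ x) = l * s := by
  have hI : ∀ u v, IntervalIntegrable Ψ volume u v :=
    fun u v => hL.continuous.intervalIntegrable u v
  have hI' : ∀ c u v, IntervalIntegrable (fun x => Ψ (x + c)) volume u v := fun c u v =>
    (hL.continuous.comp (continuous_id.add continuous_const)).intervalIntegrable u v
  rw [intervalIntegral.integral_sub (hI' _ _ _) (hI _ _),
    intervalIntegral.integral_comp_add_right (fun x => Ψ x)]
  have e1 := intervalIntegral.integral_add_adjacent_intervals (hI 0 1) (hI 1 (1 + l))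
  have e2 := intervalIntegral.integral_add_adjacent_intervals (hI 0 (0 + l)) (hI (0 + l) (1 + l))
  have e3 : ∫ x in (1 : ℝ)..(1 + l), Ψ x = (∫ x in (0 : ℝ)..(0 + l), Ψ x) + l * s := by
    have := intervalIntegral.integral_comp_add_right (a := 0) (b := l) (fun x => Ψ x) 1
    rw [zero_add, add_comm l 1] at this
    rw [← this]
    simp only [hs]
    rw [intervalIntegral.integral_add (hI _ _) (by simp)]
    simp
  linarith

/-- Between two zeros of the window increment. -/
theorem integral_abs_window_le (hL : LipschitzWith 1 Ψ) {a b κ : ℝ} (hκ : 0 ≤ κ)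
    (hκab : κ ≤ b - a) (ha : Ψ (a + l) - Ψ a = 0) (hb : Ψ (b + l) - Ψ b = 0)
    (h : ∀ x ∈ Icc a b, |Ψ (x + l) - Ψ x| ≤ κ) :
    ∫ x in a..b, |Ψ (x + l) - Ψ x| ≤ κ * (b - a) - κ ^ 2 / 2 := by
  refine integral_le_trapezoid (continuous_window hL l).abs hκ hκab h (fun x hx => ?_)
    fun x hx => ?_
  · have := abs_window_le_of_zero hL ha x
    rwa [abs_of_nonneg (sub_nonneg.2 hx.1)] at this
  · have := abs_window_le_of_zero hL hb x
    rwa [abs_sub_comm x b, abs_of_nonneg (sub_nonneg.2 hx.2)] at this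

/-- The degenerate trapezoid: the two sides meet at height `b - a`, so no plateau is needed. -/
theorem integral_abs_window_le_sq (hL : LipschitzWith 1 Ψ) {a b : ℝ} (hab : a ≤ b)
    (ha : Ψ (a + l) - Ψ a = 0) (hb : Ψ (b + l) - Ψ b = 0) :
    ∫ x in a..b, |Ψ (x + l) - Ψ x| ≤ (b - a) ^ 2 / 2 := by
  refine (integral_abs_window_le hL (sub_nonneg.2 hab) le_rfl ha hb fun x hx => ?_).trans
    (by nlinarith)
  have h1 := abs_window_le_of_zero hL ha x
  have h2 := abs_window_le_of_zero hL hb x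
  rw [abs_of_nonneg (sub_nonneg.2 hx.1)] at h1
  rw [abs_sub_comm x b, abs_of_nonneg (sub_nonneg.2 hx.2)] at h2
  linarith

/-- Two zeros that are at least `l` apart on the circle. -/
theorem integral_abs_window_le_of_zeros (hL : LipschitzWith 1 Ψ)
    (hs : ∀ x, Ψ (x + 1) = Ψ x + s) (hl : 0 ≤ l) {a b : ℝ} (h1 : l ≤ b - a)
    (h2 : l ≤ a + 1 - b) (ha : Ψ (a + l) - Ψ a = 0) (hb : Ψ (b + l) - Ψ b = 0) :
    ∫ x in a..(a + 1), |Ψ (x + l) - Ψ x| ≤ l * (1 - l) := by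
  have ha' : Ψ (a + 1 + l) - Ψ (a + 1) = 0 := by rw [← ha]; exact window_periodic hs a
  have e1 := integral_abs_window_le hL hl h1 ha hb fun x _ => abs_window_le hL hl x
  have e2 := integral_abs_window_le hL hl h2 hb ha' fun x _ => abs_window_le hL hl x
  have hI : ∀ u v, IntervalIntegrable (fun x => |Ψ (x + l) - Ψ x|) volume u v :=
    fun u v => (continuous_window hL l).abs.intervalIntegrable u v
  rw [← intervalIntegral.integral_add_adjacent_intervals (hI a b) (hI b (a + 1))]
  nlinarith

/-- The window increment is nonnegative outside a short arc. -/
theorem integral_abs_window_le_of_nonneg (hL : LipschitzWith 1 Ψ)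
    (hs : ∀ x, Ψ (x + 1) = Ψ x + s) (hl : 0 ≤ l) (hl2 : l ≤ 1 / 2) (hsl : s ≤ 1 - l) {a b : ℝ}
    (hba : b ≤ a) (hab : a ≤ b + 1) (hshort : b + 1 - a ≤ l)
    (ha : Ψ (a + l) - Ψ a = 0) (hb : Ψ (b + l) - Ψ b = 0)
    (hpos : ∀ x ∈ Icc b a, 0 ≤ Ψ (x + l) - Ψ x) :
    ∫ x in b..(b + 1), |Ψ (x + l) - Ψ x| ≤ l * (1 - l) := by
  have hb' : Ψ (b + 1 + l) - Ψ (b + 1) = 0 := by rw [← hb]; exact window_periodic hs b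
  have hc := continuous_window hL l
  have hI : ∀ u v, IntervalIntegrable (fun x => Ψ (x + l) - Ψ x) volume u v :=
    fun u v => hc.intervalIntegrable u v
  have hcm : Continuous fun x => max (-(Ψ (x + l) - Ψ x)) 0 := hc.neg.max continuous_const
  have hIm : ∀ u v, IntervalIntegrable (fun x => max (-(Ψ (x + l) - Ψ x)) 0) volume u v :=
    fun u v => hcm.intervalIntegrable u v
  have htot : ∫ x in b..(b + 1), (Ψ (x + l) - Ψ x) = l * s := by
    rw [(window_periodic hs).intervalIntegral_add_eq b 0, zero_add, integral_window hL hs]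
  -- From `|w| = w + 2 w⁻`: the integral of `w` is known to be `l s`, so only the negative part on
  -- the short arc has to be bounded.
  have h1 : ∫ x in b..(b + 1), |Ψ (x + l) - Ψ x|
      = l * s + 2 * ∫ x in b..(b + 1), max (-(Ψ (x + l) - Ψ x)) 0 := by
    rw [← htot, ← intervalIntegral.integral_const_mul,
      ← intervalIntegral.integral_add (hI _ _) ((hIm _ _).const_mul 2)]
    refine intervalIntegral.integral_congr fun x _ => ?_
    rcases le_total 0 (Ψ (x + l) - Ψ x) with h | h
    · rw [abs_of_nonneg h, max_eq_right (by linarith)]; ring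
    · rw [abs_of_nonpos h, max_eq_left (by linarith)]; ring
  have h2 : ∫ x in b..a, max (-(Ψ (x + l) - Ψ x)) 0 = 0 := by
    rw [intervalIntegral.integral_congr (g := fun _ => (0 : ℝ)), intervalIntegral.integral_zero]
    intro x hx
    rw [uIcc_of_le hba] at hx
    exact max_eq_right (by linarith [hpos x hx])
  set d := 1 - l - s with hd
  -- `Ψ (x + 1) - Ψ (x + l) ≤ 1 - l` and `Ψ (x + 1) = Ψ x + s` bound the depth of the negative part
  -- by `d`.
  have hstep : ∀ x, -(Ψ (x + l) - Ψ x) ≤ d := by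
    intro x
    have := abs_increment_le hL (x + 1) (x + l)
    rw [hs x, show x + 1 - (x + l) = 1 - l by ring, abs_of_nonneg (by linarith : 0 ≤ 1 - l),
      abs_le] at this
    linarith [this.2]
  -- The zeros give `Ψ (a + l) = Ψ a` and `Ψ (b + 1 + l) = Ψ (b + 1)`, so `s` is the sum of the
  -- increments from `b + 1 + l` to `a + 1` and from `a + l` to `b + 1`; both are bounded by the
  -- Lipschitz property.
  have hd2 : 2 * (b + 1 - a) - l ≤ d := by
    have e1 := abs_increment_le hL (a + 1) (b + 1 + l)
    have e2 := abs_increment_le hL (b + 1) (a + l)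
    rw [abs_of_nonneg (by linarith : 0 ≤ a + 1 - (b + 1 + l)), abs_le] at e1
    rw [abs_of_nonpos (by linarith : b + 1 - (a + l) ≤ 0), abs_le] at e2
    have := hs a
    linarith [e1.2, e2.2]
  have hκ : 0 ≤ min d (b + 1 - a) := le_min (by linarith) (by linarith)
  have h3 : ∫ x in a..(b + 1), max (-(Ψ (x + l) - Ψ x)) 0
      ≤ min d (b + 1 - a) * (b + 1 - a) - min d (b + 1 - a) ^ 2 / 2 := by
    have ha2 : ∀ x ∈ Icc a (b + 1), max (-(Ψ (x + l) - Ψ x)) 0 ≤ 2 * (x - a) := by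
      intro x hx
      have := abs_window_le_of_zero hL ha x
      rw [abs_of_nonneg (sub_nonneg.2 hx.1)] at this
      exact max_le ((neg_le_abs _).trans this) (by linarith [hx.1])
    have hb2 : ∀ x ∈ Icc a (b + 1), max (-(Ψ (x + l) - Ψ x)) 0 ≤ 2 * (b + 1 - x) := by
      intro x hx
      have := abs_window_le_of_zero hL hb' x
      rw [abs_sub_comm x, abs_of_nonneg (sub_nonneg.2 hx.2)] at this
      exact max_le ((neg_le_abs _).trans this) (by linarith [hx.2])
    refine integral_le_trapezoid hcm hκ (min_le_right _ _) (fun x hx => ?_) ha2 hb2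
    refine le_min (max_le (hstep x) (by linarith)) ?_
    linarith [ha2 x hx, hb2 x hx]
  have h4 := intervalIntegral.integral_add_adjacent_intervals (hIm b a) (hIm a (b + 1))
  -- Twice the trapezoid area is at most `l d`, which with `l s` adds up to `l (1 - l)`.
  have h5 : min d (b + 1 - a) * (2 * (b + 1 - a) - min d (b + 1 - a)) ≤ l * d := by
    have k1 : min d (b + 1 - a) ≤ d := min_le_left _ _
    have k2 : 2 * (b + 1 - a) - min d (b + 1 - a) ≤ l := by
      rcases min_choice d (b + 1 - a) with h | h <;> rw [h] <;> linarith
    nlinarith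
  rw [h1, ← h4, h2]
  nlinarith

/-- The case where the window increment is positive on the middle arc opposite to a zero. -/
theorem integral_abs_window_le_of_pos (hL : LipschitzWith 1 Ψ)
    (hs : ∀ x, Ψ (x + 1) = Ψ x + s) (hl : 0 < l) (hl2 : l ≤ 1 / 2) (hsl : s ≤ 1 - l) {z : ℝ}
    (hz : Ψ (z + l) - Ψ z = 0) (hpos : ∀ x ∈ Icc (z + l) (z + 1 - l), 0 < Ψ (x + l) - Ψ x) :
    ∫ x in (0 : ℝ)..1, |Ψ (x + l) - Ψ x| ≤ l * (1 - l) := by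
  have hc := continuous_window hL l
  have hper : Function.Periodic (fun x => |Ψ (x + l) - Ψ x|) 1 := fun x =>
    congrArg abs (window_periodic (l := l) hs x)
  have hz' : Ψ (z + 1 + l) - Ψ (z + 1) = 0 := by rw [← hz]; exact window_periodic hs z
  -- `b` is the last zero after `z` and `a` the first zero before `z + 1`, as seen from the positive
  -- middle arc; thus the increment is nonnegative on `[b, a]`.
  obtain ⟨b, ⟨hb, hb0⟩, hbmax⟩ := (isCompact_Icc.inter_right
    (isClosed_singleton.preimage hc) : IsCompact
      (Icc z (z + l) ∩ (fun x => Ψ (x + l) - Ψ x) ⁻¹' {0})).exists_isGreatest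
    ⟨z, ⟨le_rfl, by linarith⟩, hz⟩
  obtain ⟨a, ⟨ha, ha0⟩, hamin⟩ := (isCompact_Icc.inter_right
    (isClosed_singleton.preimage hc) : IsCompact
      (Icc (z + 1 - l) (z + 1) ∩ (fun x => Ψ (x + l) - Ψ x) ⁻¹' {0})).exists_isLeast
    ⟨z + 1, ⟨by linarith, le_rfl⟩, hz'⟩
  simp only [mem_preimage, mem_singleton_iff] at hb0 ha0
  have hbl : b < z + l := lt_of_le_of_ne hb.2 fun h => by
    have := hpos b ⟨h.ge, by linarith⟩
    linarith
  have hal : z + 1 - l < a := lt_of_le_of_ne ha.1 fun h => by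
    have := hpos a ⟨by linarith, h.ge⟩
    linarith
  have hshift : ∀ t : ℝ, ∫ x in (0 : ℝ)..1, |Ψ (x + l) - Ψ x|
      = ∫ x in t..(t + 1), |Ψ (x + l) - Ψ x| := fun t => by
    rw [hper.intervalIntegral_add_eq t 0, zero_add]
  rcases le_total (b + 1 - a) l with hsh | hsh
  · rw [hshift b]
    refine integral_abs_window_le_of_nonneg hL hs hl.le hl2 hsl (by linarith) (by linarith [hb.1, ha.2])
      hsh ha0 hb0 fun x hx => ?_
    by_contra! hneg
    by_cases hx1 : x < z + l
    · obtain ⟨y, hy, hy0⟩ := intermediate_value_Icc hx1.le hc.continuousOn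
        (⟨hneg.le, (hpos (z + l) ⟨le_rfl, by linarith⟩).le⟩ : (0 : ℝ) ∈ Icc _ _)
      have hyb := hbmax ⟨⟨by linarith [hb.1, hx.1, hy.1], hy.2⟩, hy0⟩
      have hxb : x = b := le_antisymm (by linarith [hy.1]) hx.1
      rw [hxb] at hneg
      linarith
    · by_cases hx2 : x ≤ z + 1 - l
      · linarith [hpos x ⟨by linarith, hx2⟩]
      · obtain ⟨y, hy, hy0⟩ := intermediate_value_Icc' (lt_of_not_ge hx2).le hc.continuousOn
          (⟨hneg.le, (hpos (z + 1 - l) ⟨by linarith, le_rfl⟩).le⟩ : (0 : ℝ) ∈ Icc _ _)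
        have hya := hamin ⟨⟨hy.1, by linarith [ha.2, hx.2, hy.2]⟩, hy0⟩
        have hxa : x = a := le_antisymm hx.2 (by linarith [hy.2])
        rw [hxa] at hneg
        linarith
  · rcases le_total l (a - b) with hab | hab
    · rw [hshift b]
      exact integral_abs_window_le_of_zeros hL hs hl.le hab hsh hb0 ha0
    -- All three arcs between the zeros `z`, `b`, `a`, `z + 1` have length at most `l`, so the
    -- triangles sum to at most `l / 2 ≤ l (1 - l)`.
    · rw [hshift z]
      have hI : ∀ u v, IntervalIntegrable (fun x => |Ψ (x + l) - Ψ x|) volume u v :=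
        fun u v => hc.abs.intervalIntegrable u v
      have e1 := integral_abs_window_le_sq hL hb.1 hz hb0
      have e2 := integral_abs_window_le_sq hL (by linarith : b ≤ a) hb0 ha0
      have e3 := integral_abs_window_le_sq hL ha.2 ha0 hz'
      have e4 := intervalIntegral.integral_add_adjacent_intervals (hI z b) (hI b a)
      have e5 := intervalIntegral.integral_add_adjacent_intervals (hI z a) (hI a (z + 1))
      have k1 : (b - z) ^ 2 ≤ l * (b - z) := by nlinarith [hb.1]
      have k2 : (a - b) ^ 2 ≤ l * (a - b) := by nlinarith
      have k3 : (z + 1 - a) ^ 2 ≤ l * (z + 1 - a) := by nlinarith [ha.2]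
      nlinarith

/-- The sharp `L¹` bound for the increments over windows of length `l` of a `1`-Lipschitz function
with periodic derivative. -/
theorem integral_abs_window_le_mul (hL : LipschitzWith 1 Ψ)
    (hs : ∀ x, Ψ (x + 1) = Ψ x + s) (hl : 0 < l) (hl2 : l ≤ 1 / 2) (hsl : |s| ≤ 1 - l) :
    ∫ x in (0 : ℝ)..1, |Ψ (x + l) - Ψ x| ≤ l * (1 - l) := by
  have hc := continuous_window hL l
  have hLn : LipschitzWith 1 (fun x => -Ψ x) := hL.neg
  have hsn : ∀ x, -Ψ (x + 1) = -Ψ x + -s := fun x => by rw [hs]; ring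
  have hneg : ∀ x, -Ψ (x + l) - -Ψ x = -(Ψ (x + l) - Ψ x) := fun x => by ring
  rw [abs_le] at hsl
  by_cases hzero : ∃ z, Ψ (z + l) - Ψ z = 0
  · obtain ⟨z, hz⟩ := hzero
    by_cases hJ : ∃ y ∈ Icc (z + l) (z + 1 - l), Ψ (y + l) - Ψ y = 0
    · obtain ⟨y, hy, hy0⟩ := hJ
      have hper : Function.Periodic (fun x => |Ψ (x + l) - Ψ x|) 1 := fun x =>
        congrArg abs (window_periodic (l := l) hs x)
      have := integral_abs_window_le_of_zeros hL hs hl.le (by linarith [hy.1])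
        (by linarith [hy.2]) hz hy0
      rwa [hper.intervalIntegral_add_eq z 0, zero_add] at this
    -- With no zero on the middle arc the increment has one sign there; replacing `Ψ` by `-Ψ` makes
    -- it positive.
    · push Not at hJ
      have hle : z + l ≤ z + 1 - l := by linarith
      have hm : z + l ∈ Icc (z + l) (z + 1 - l) := ⟨le_rfl, hle⟩
      rcases lt_or_gt_of_ne (hJ _ hm) with h | h
      · have := integral_abs_window_le_of_pos hLn hsn hl hl2 (by linarith) (z := z)
          (by rw [hneg, hz, neg_zero]) fun x hx => ?_
        · simpa only [hneg, abs_neg] using this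
        · rw [hneg]
          by_contra! hx0
          obtain ⟨y, hy, hy0⟩ := intermediate_value_Icc hx.1 hc.continuousOn
            (⟨h.le, by linarith⟩ : (0 : ℝ) ∈ Icc _ _)
          exact hJ y ⟨hy.1, hy.2.trans hx.2⟩ hy0
      · refine integral_abs_window_le_of_pos hL hs hl hl2 (by linarith) hz fun x hx => ?_
        by_contra! hx0
        obtain ⟨y, hy, hy0⟩ := intermediate_value_Icc' hx.1 hc.continuousOn
          (⟨hx0, h.le⟩ : (0 : ℝ) ∈ Icc _ _)
        exact hJ y ⟨hy.1, hy.2.trans hx.2⟩ hy0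
  -- Without zeros the sign is constant and the integral is `l |s|`.
  · push Not at hzero
    have hint := integral_window (l := l) hL hs
    have hsign : (∀ x, 0 < Ψ (x + l) - Ψ x) ∨ ∀ x, Ψ (x + l) - Ψ x < 0 := by
      by_contra! h
      obtain ⟨⟨x, hx⟩, y, hy⟩ := h
      obtain ⟨w, hw⟩ := mem_range_of_exists_le_of_exists_ge hc ⟨x, hx⟩ ⟨y, hy⟩
      exact hzero w hw
    rcases hsign with h | h
    · simp only [abs_of_pos (h _), hint]
      nlinarith
    · simp only [abs_of_neg (h _), intervalIntegral.integral_neg, hint]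
      nlinarith

end WindowIncrement

/-! ### Autocorrelation of a bounded periodic profile over a band. -/

theorem intervalIntegrable_of_abs_le {f : ℝ → ℝ} (hf : Measurable f) {C : ℝ}
    (hC : ∀ x, |f x| ≤ C) (a b : ℝ) : IntervalIntegrable f volume a b := by
  rw [intervalIntegrable_iff]
  exact Measure.integrableOn_of_bounded (M := C) (by simp) hf.aestronglyMeasurable
    (Eventually.of_forall hC)

section Spin

variable {ψ : ℝ → ℝ}

theorem lipschitzWith_primitive (hm : Measurable ψ) (hb : ∀ x, |ψ x| ≤ 1) :
    LipschitzWith 1 fun x => ∫ t in (0 : ℝ)..x, ψ t := by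
  refine LipschitzWith.of_dist_le_mul fun x y => ?_
  rw [Real.dist_eq, Real.dist_eq, intervalIntegral.integral_interval_sub_left
    (intervalIntegrable_of_abs_le hm hb _ _) (intervalIntegrable_of_abs_le hm hb _ _)]
  exact (intervalIntegral.norm_integral_le_of_norm_le_const (f := ψ) (C := 1) fun t _ => hb t)

theorem primitive_add_one (hm : Measurable ψ) (hb : ∀ x, |ψ x| ≤ 1)
    (hp : Function.Periodic ψ 1) (x : ℝ) :
    ∫ t in (0 : ℝ)..(x + 1), ψ t = (∫ t in (0 : ℝ)..x, ψ t) + ∫ t in (0 : ℝ)..1, ψ t := by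
  have hI := intervalIntegrable_of_abs_le hm hb
  rw [← intervalIntegral.integral_add_adjacent_intervals (hI 0 x) (hI x (x + 1)),
    hp.intervalIntegral_add_eq x 0, zero_add]

theorem integral_window_eq (hm : Measurable ψ) (hb : ∀ x, |ψ x| ≤ 1) (l x : ℝ) :
    ∫ t in (x - l / 2)..(x + l / 2), ψ t
      = (∫ t in (0 : ℝ)..(x - l / 2 + l), ψ t) - ∫ t in (0 : ℝ)..(x - l / 2), ψ t := by
  have hI := intervalIntegrable_of_abs_le hm hb
  rw [intervalIntegral.integral_interval_sub_left (hI _ _) (hI _ _)]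
  congr 1
  ring

theorem continuous_integral_window (hm : Measurable ψ) (hb : ∀ x, |ψ x| ≤ 1) (l : ℝ) :
    Continuous fun x => ∫ t in (x - l / 2)..(x + l / 2), ψ t := by
  simp only [integral_window_eq hm hb]
  exact (continuous_window (lipschitzWith_primitive hm hb) l).comp
    (continuous_id.sub continuous_const)

theorem window_primitive_periodic (hm : Measurable ψ) (hb : ∀ x, |ψ x| ≤ 1)
    (hp : Function.Periodic ψ 1) (l : ℝ) :
    Function.Periodic (fun x => (∫ t in (0 : ℝ)..(x + l), ψ t) - ∫ t in (0 : ℝ)..x, ψ t) 1 :=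
  window_periodic (Ψ := fun x => ∫ t in (0 : ℝ)..x, ψ t) (primitive_add_one hm hb hp)

theorem integral_integral_window (hm : Measurable ψ) (hb : ∀ x, |ψ x| ≤ 1)
    (hp : Function.Periodic ψ 1) (l : ℝ) :
    ∫ x in (0 : ℝ)..1, ∫ t in (x - l / 2)..(x + l / 2), ψ t = l * ∫ t in (0 : ℝ)..1, ψ t := by
  simp only [integral_window_eq hm hb]
  rw [intervalIntegral.integral_comp_sub_right
    (fun x => (∫ t in (0 : ℝ)..(x + l), ψ t) - ∫ t in (0 : ℝ)..x, ψ t), zero_sub,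
    show 1 - l / 2 = -(l / 2) + 1 by ring,
    (window_primitive_periodic hm hb hp l).intervalIntegral_add_eq _ 0, zero_add]
  exact integral_window (lipschitzWith_primitive hm hb) (primitive_add_one hm hb hp)

theorem integral_abs_integral_window_le (hm : Measurable ψ) (hb : ∀ x, |ψ x| ≤ 1)
    (hp : Function.Periodic ψ 1) {l : ℝ} (hl : 0 < l) (hl2 : l ≤ 1 / 2)
    (hs : |∫ t in (0 : ℝ)..1, ψ t| ≤ 1 - l) (c : ℝ) :
    ∫ x in (0 : ℝ)..1, |∫ t in (x - c)..(x - c + l), ψ t| ≤ l * (1 - l) := by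
  have hI := intervalIntegrable_of_abs_le hm hb
  have e : ∀ x, ∫ t in (x - c)..(x - c + l), ψ t
      = (∫ t in (0 : ℝ)..(x - c + l), ψ t) - ∫ t in (0 : ℝ)..(x - c), ψ t := fun x =>
    (intervalIntegral.integral_interval_sub_left (hI _ _) (hI _ _)).symm
  have hper : Function.Periodic
      (fun x => |(∫ t in (0 : ℝ)..(x + l), ψ t) - ∫ t in (0 : ℝ)..x, ψ t|) 1 := fun x =>
    congrArg abs (window_primitive_periodic hm hb hp l x)
  simp only [e]
  rw [intervalIntegral.integral_comp_sub_right
    (fun x => |(∫ t in (0 : ℝ)..(x + l), ψ t) - ∫ t in (0 : ℝ)..x, ψ t|), zero_sub,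
    show 1 - c = -c + 1 by ring, hper.intervalIntegral_add_eq _ 0, zero_add]
  exact integral_abs_window_le_mul (lipschitzWith_primitive hm hb)
    (primitive_add_one hm hb hp) hl hl2 hs

theorem intervalIntegrable_mul_of_abs_le (hm : Measurable ψ) (hb : ∀ x, |ψ x| ≤ 1) {P : ℝ → ℝ}
    (hP : Continuous P) (a b : ℝ) : IntervalIntegrable (fun x => ψ x * P x) volume a b := by
  have h := (intervalIntegrable_of_abs_le hm hb a b).mul_continuousOn hP.continuousOn
  exact h

theorem abs_integral_mul_le (hm : Measurable ψ) (hb : ∀ x, |ψ x| ≤ 1) {P : ℝ → ℝ}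
    (hP : Continuous P) : |∫ x in (0 : ℝ)..1, ψ x * P x| ≤ ∫ x in (0 : ℝ)..1, |P x| := by
  refine (intervalIntegral.abs_integral_le_integral_abs zero_le_one).trans ?_
  refine intervalIntegral.integral_mono_on zero_le_one
    (intervalIntegrable_mul_of_abs_le hm hb hP _ _).abs (hP.abs.intervalIntegrable _ _)
    fun x _ => ?_
  rw [abs_mul]
  exact mul_le_of_le_one_left (abs_nonneg _) (hb x)

/-- The function `1 - ψ` is nonnegative, so its integral over a window is at most `1 - s`, its
integral over a period. Multiplying by `1 - ψ` and integrating gives `∫ ψ P ≤ (1 - l) (1 - 2 s) +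
s²`, and `1 - 2 s ≤ l` is the assumption on `s`. -/
theorem integral_mul_window_le_of_large (hm : Measurable ψ) (hb : ∀ x, |ψ x| ≤ 1)
    (hp : Function.Periodic ψ 1) {l : ℝ} (hl : 0 < l) (hl1 : l < 1)
    (hs : (1 - l) / 2 ≤ ∫ t in (0 : ℝ)..1, ψ t) :
    ∫ x in (0 : ℝ)..1, ψ x * ∫ t in (x - l / 2)..(x + l / 2), ψ t
      ≤ l * (1 - l) + (∫ t in (0 : ℝ)..1, ψ t) ^ 2 := by
  have hI := intervalIntegrable_of_abs_le hm hb
  set s := ∫ t in (0 : ℝ)..1, ψ t with hsdef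
  have hPc := continuous_integral_window hm hb l
  set P : ℝ → ℝ := fun x => ∫ t in (x - l / 2)..(x + l / 2), ψ t with hP
  have hPI : ∫ x in (0 : ℝ)..1, P x = l * s := integral_integral_window hm hb hp l
  have hlow : ∀ x, l - P x ≤ 1 - s := by
    intro x
    have hw : l - P x = ∫ t in (x - l / 2)..(x + l / 2), (1 - ψ t) := by
      rw [intervalIntegral.integral_sub (by simp) (hI _ _)]
      simp only [intervalIntegral.integral_const, smul_eq_mul, hP]
      ring
    have h1 : 1 - s = ∫ t in (x - l / 2)..(x - l / 2 + 1), (1 - ψ t) := by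
      rw [intervalIntegral.integral_sub (by simp) (hI _ _), hp.intervalIntegral_add_eq _ 0,
        zero_add, ← hsdef]
      simp
    rw [hw, h1]
    exact intervalIntegral.integral_mono_interval le_rfl (by linarith) (by linarith)
      (Eventually.of_forall fun t => by
        change 0 ≤ 1 - ψ t
        linarith [(abs_le.1 (hb t)).2])
      ((intervalIntegrable_const).sub (hI _ _))
  have hψP := intervalIntegrable_mul_of_abs_le hm hb hPc 0 1
  have hPi := hPc.intervalIntegrable (μ := volume) 0 1
  have key : ∫ x in (0 : ℝ)..1, (1 - ψ x) * (l - P x) ≤ ∫ x in (0 : ℝ)..1, (1 - ψ x) * (1 - s) := by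
    refine intervalIntegral.integral_mono_on zero_le_one ?_
      ((intervalIntegrable_const.sub (hI _ _)).mul_const _) fun x _ =>
      mul_le_mul_of_nonneg_left (hlow x) (by linarith [(abs_le.1 (hb x)).2])
    exact (intervalIntegrable_const.sub (hI _ _)).mul_continuousOn
      (continuous_const.sub hPc).continuousOn
  have e1 : ∫ x in (0 : ℝ)..1, (1 - ψ x) * (1 - s) = (1 - s) ^ 2 := by
    rw [intervalIntegral.integral_mul_const, intervalIntegral.integral_sub (by simp) (hI _ _)]
    simp only [intervalIntegral.integral_const, smul_eq_mul, ← hsdef]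
    ring
  have e2 : ∫ x in (0 : ℝ)..1, (1 - ψ x) * (l - P x)
      = l - l * s - l * s + ∫ x in (0 : ℝ)..1, ψ x * P x := by
    have : ∀ x, (1 - ψ x) * (l - P x) = l - l * ψ x - P x + ψ x * P x := fun x => by ring
    rw [funext this, intervalIntegral.integral_add
      ((intervalIntegrable_const.sub ((hI _ _).const_mul l)).sub hPi) hψP,
      intervalIntegral.integral_sub (intervalIntegrable_const.sub ((hI _ _).const_mul l)) hPi,
      intervalIntegral.integral_sub intervalIntegrable_const ((hI _ _).const_mul l),
      intervalIntegral.integral_const_mul, hPI, ← hsdef]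
    simp
  rw [e1, e2] at key
  nlinarith

/-- A Riesz rearrangement inequality on the circle for the autocorrelation over a band. -/
theorem integral_mul_window_le (hm : Measurable ψ) (hb : ∀ x, |ψ x| ≤ 1)
    (hp : Function.Periodic ψ 1) {l : ℝ} (hl : 0 < l) (hl1 : l < 1) :
    ∫ x in (0 : ℝ)..1, ψ x * ∫ t in (x - l / 2)..(x + l / 2), ψ t
      ≤ l * (1 - l) + (∫ t in (0 : ℝ)..1, ψ t) ^ 2 := by
  have hI := intervalIntegrable_of_abs_le hm hb
  rcases le_total ((1 - l) / 2) |∫ t in (0 : ℝ)..1, ψ t| with hs | hs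
  · rcases le_abs.1 hs with h | h
    · exact integral_mul_window_le_of_large hm hb hp hl hl1 h
    · have := integral_mul_window_le_of_large (ψ := fun x => -ψ x) hm.neg
        (fun x => by rw [abs_neg]; exact hb x) (fun x => congrArg Neg.neg (hp x)) hl hl1
        (by rwa [intervalIntegral.integral_neg])
      simpa only [intervalIntegral.integral_neg, neg_mul_neg, neg_sq] using this
  · rcases le_total l (1 / 2) with hl2 | hl2
    · have h1 := abs_integral_mul_le hm hb (continuous_integral_window hm hb l)
      have h2 := integral_abs_integral_window_le hm hb hp hl hl2 (by linarith) (l / 2)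
      simp only [show ∀ x : ℝ, x - l / 2 + l = x + l / 2 from fun x => by ring] at h2
      have := le_abs_self (∫ x in (0 : ℝ)..1, ψ x * ∫ t in (x - l / 2)..(x + l / 2), ψ t)
      nlinarith [sq_nonneg (∫ t in (0 : ℝ)..1, ψ t)]
    -- For `l ≥ 1/2`, `P` is `s` minus the integral over the complementary window of length `1 - l`.
    -- The product `s · s` supplies the term `s²`, and `l (1 - l)` is symmetric under `l ↦ 1 - l`.
    · have hc : Continuous fun x => ∫ t in (x - -(l / 2))..(x - -(l / 2) + (1 - l)), ψ t := by
        rw [funext fun x => (intervalIntegral.integral_interval_sub_left (hI 0 (x - -(l / 2) + (1 - l)))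
          (hI 0 (x - -(l / 2)))).symm]
        exact (continuous_window (lipschitzWith_primitive hm hb) (1 - l)).comp
          (continuous_id.sub continuous_const)
      have h1 := abs_integral_mul_le hm hb hc
      have h2 := integral_abs_integral_window_le hm hb hp (l := 1 - l) (by linarith)
        (by linarith) (by linarith) (-(l / 2))
      have e : ∀ x, ∫ t in (x - l / 2)..(x + l / 2), ψ t = (∫ t in (0 : ℝ)..1, ψ t)
          - ∫ t in (x - -(l / 2))..(x - -(l / 2) + (1 - l)), ψ t := by
        intro x
        have h3 := hp.intervalIntegral_add_eq (x - l / 2) 0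
        rw [zero_add, ← intervalIntegral.integral_add_adjacent_intervals
          (hI (x - l / 2) (x + l / 2)) (hI (x + l / 2) _)] at h3
        rw [← h3, sub_neg_eq_add, show x + l / 2 + (1 - l) = x - l / 2 + 1 by ring]
        ring
      simp only [e, mul_sub]
      rw [intervalIntegral.integral_sub ((hI _ _).mul_const _)
        (intervalIntegrable_mul_of_abs_le hm hb hc _ _), intervalIntegral.integral_mul_const]
      have := neg_abs_le (∫ x in (0 : ℝ)..1,
        ψ x * ∫ t in (x - -(l / 2))..(x - -(l / 2) + (1 - l)), ψ t)
      nlinarith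

end Spin

/-! ### The cell functional and its lower bound. -/

section Band

variable {α β l : ℝ}

theorem measurable_bandWeight (α β l : ℝ) : Measurable (bandWeight α β l) := by
  unfold bandWeight
  refine Measurable.ite ?_ measurable_const measurable_const
  exact (measurableSet_lt measurable_fract measurable_const).union
    (measurableSet_le measurable_const measurable_fract)

theorem bandWeight_periodic (α β l : ℝ) : Function.Periodic (bandWeight α β l) 1 := fun x => by
  simp [bandWeight]

theorem bandWeight_mem_Icc (h : α ≤ β) (t : ℝ) : bandWeight α β l t ∈ Icc α β := by
  unfold bandWeight
  split_ifs <;> simp [h]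

theorem bandWeight_of_mem_band (hl1 : l < 1) {t : ℝ} (h1 : -(l / 2) < t) (h2 : t < l / 2) :
    bandWeight α β l t = α := by
  refine if_pos ?_
  rcases le_or_gt 0 t with h | h
  · left
    rwa [Int.fract_eq_self.2 ⟨h, by linarith⟩]
  · right
    rw [← Int.fract_add_one, Int.fract_eq_self.2 ⟨by linarith, by linarith⟩]
    linarith

theorem bandWeight_of_lt_abs (hl : 0 < l) {t : ℝ} (h1 : l / 2 < |t|) (h2 : |t| < 1 / 2) :
    bandWeight α β l t = β := by
  refine if_neg ?_
  rw [lt_abs] at h1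
  rw [abs_lt] at h2
  rcases le_or_gt 0 t with h | h
  · rw [Int.fract_eq_self.2 ⟨h, by linarith⟩]
    rintro (h | h) <;> rcases h1 with h1 | h1 <;> linarith
  · rw [← Int.fract_add_one, Int.fract_eq_self.2 ⟨by linarith, by linarith⟩]
    rintro (h | h) <;> rcases h1 with h1 | h1 <;> linarith

theorem integral_congr_of_eqOn_Ioo {f g : ℝ → ℝ} {a b : ℝ} (hab : a ≤ b)
    (h : ∀ x ∈ Ioo a b, f x = g x) : ∫ x in a..b, f x = ∫ x in a..b, g x := by
  rw [intervalIntegral.integral_of_le hab, intervalIntegral.integral_of_le hab,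
    integral_Ioc_eq_integral_Ioo, integral_Ioc_eq_integral_Ioo]
  exact setIntegral_congr_fun measurableSet_Ioo h

/-- On the period centred at `x`, the weight is `β` minus `β - α` times the indicator of the band
`|x - y| < l / 2`, up to null sets. -/
theorem integral_bandWeight_mul (hl : 0 < l) (hl1 : l < 1) {G : ℝ → ℝ}
    (hm : Measurable G) {C : ℝ} (hC : ∀ x, |G x| ≤ C) (hp : Function.Periodic G 1) (x : ℝ) :
    ∫ y in (0 : ℝ)..1, bandWeight α β l (x - y) * G y
      = β * (∫ y in (0 : ℝ)..1, G y) - (β - α) * ∫ y in (x - l / 2)..(x + l / 2), G y := by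
  have hI := intervalIntegrable_of_abs_le hm hC
  have hper : Function.Periodic (fun y => bandWeight α β l (x - y) * G y) 1 := fun y => by
    have := (bandWeight_periodic α β l).sub_eq (x - y)
    simp only [hp y, show x - (y + 1) = x - y - 1 by ring, this]
  have hJ : ∀ a b, IntervalIntegrable (fun y => bandWeight α β l (x - y) * G y) volume a b := by
    refine intervalIntegrable_of_abs_le (C := (|α| + |β|) * C)
      (((measurable_bandWeight α β l).comp (measurable_const.sub measurable_id)).mul hm)
      fun y => ?_
    rw [abs_mul]
    refine mul_le_mul ?_ (hC y) (abs_nonneg _) (by positivity)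
    unfold bandWeight
    split_ifs
    · linarith [abs_nonneg β]
    · linarith [abs_nonneg α]
  have h0 := hper.intervalIntegral_add_eq 0 (x - 1 / 2)
  have h0' := hp.intervalIntegral_add_eq 0 (x - 1 / 2)
  rw [zero_add, show x - 1 / 2 + 1 = x + 1 / 2 by ring] at h0 h0'
  rw [h0, h0', ← intervalIntegral.integral_add_adjacent_intervals (hJ _ (x - l / 2)) (hJ _ _),
    ← intervalIntegral.integral_add_adjacent_intervals (hJ (x - l / 2) (x + l / 2)) (hJ _ _),
    ← intervalIntegral.integral_add_adjacent_intervals (hI _ (x - l / 2)) (hI _ _),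
    ← intervalIntegral.integral_add_adjacent_intervals (hI (x - l / 2) (x + l / 2)) (hI _ _),
    integral_congr_of_eqOn_Ioo (g := fun y => β * G y) (by linarith) fun y hy => ?_,
    integral_congr_of_eqOn_Ioo (a := x - l / 2) (g := fun y => α * G y) (by linarith) fun y hy => ?_,
    integral_congr_of_eqOn_Ioo (a := x + l / 2) (g := fun y => β * G y) (by linarith) fun y hy => ?_]
  · simp only [intervalIntegral.integral_const_mul]
    ring
  · rw [bandWeight_of_lt_abs hl (lt_abs.2 (Or.inr (by linarith [hy.1, hy.2])))
      (abs_lt.2 ⟨by linarith [hy.1, hy.2], by linarith [hy.1, hy.2]⟩)]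
  · rw [bandWeight_of_mem_band hl1 (by linarith [hy.1, hy.2]) (by linarith [hy.1, hy.2])]
  · rw [bandWeight_of_lt_abs hl (lt_abs.2 (Or.inl (by linarith [hy.1, hy.2])))
      (abs_lt.2 ⟨by linarith [hy.1, hy.2], by linarith [hy.1, hy.2]⟩)]

/-- The cell functional in the variable `ψ = 2 φ - 1`. -/
noncomputable def spinEnergy (α β l : ℝ) (ψ : ℝ → ℝ) : ℝ :=
  ∫ x in (0 : ℝ)..1, ∫ y in (0 : ℝ)..1, bandWeight α β l (x - y) * ((1 + ψ x * ψ y) / 2)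

theorem spinEnergy_eq (hl : 0 < l) (hl1 : l < 1) {ψ : ℝ → ℝ}
    (hm : Measurable ψ) (hb : ∀ x, |ψ x| ≤ 1) (hp : Function.Periodic ψ 1) :
    spinEnergy α β l ψ = (β - (β - α) * l + β * (∫ x in (0 : ℝ)..1, ψ x) ^ 2
      - (β - α) * ∫ x in (0 : ℝ)..1, ψ x * ∫ y in (x - l / 2)..(x + l / 2), ψ y) / 2 := by
  have hI := intervalIntegrable_of_abs_le hm hb
  have inner : ∀ x, ∫ y in (0 : ℝ)..1, bandWeight α β l (x - y) * ((1 + ψ x * ψ y) / 2)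
      = (β - (β - α) * l) / 2 + β * (∫ x in (0 : ℝ)..1, ψ x) / 2 * ψ x
        - (β - α) / 2 * (ψ x * ∫ y in (x - l / 2)..(x + l / 2), ψ y) := by
    intro x
    have hx := abs_le.1 (hb x)
    rw [integral_bandWeight_mul (G := fun y => (1 + ψ x * ψ y) / 2) (C := 1) hl hl1
      (by fun_prop) ?_ ?_ x]
    · simp only [intervalIntegral.integral_div]
      rw [intervalIntegral.integral_add intervalIntegrable_const ((hI _ _).const_mul _),
        intervalIntegral.integral_add intervalIntegrable_const ((hI _ _).const_mul _)]
      simp only [intervalIntegral.integral_const_mul, intervalIntegral.integral_const,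
        smul_eq_mul]
      ring
    · intro y
      have h := abs_le.1 ((abs_mul (ψ x) (ψ y)).trans_le
        (mul_le_one₀ (hb x) (abs_nonneg _) (hb y)))
      rw [abs_le]
      constructor <;> linarith [h.1, h.2]
    · intro y
      simp only [hp y]
  unfold spinEnergy
  simp only [inner]
  have hψP := intervalIntegrable_mul_of_abs_le hm hb (continuous_integral_window hm hb l) 0 1
  rw [intervalIntegral.integral_sub (intervalIntegrable_const.add ((hI _ _).const_mul _))
    (hψP.const_mul _), intervalIntegral.integral_add intervalIntegrable_const
    ((hI _ _).const_mul _), intervalIntegral.integral_const_mul,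
    intervalIntegral.integral_const_mul, intervalIntegral.integral_const]
  simp only [smul_eq_mul]
  ring

theorem le_spinEnergy_of_periodic (hα : 0 ≤ α) (hαβ : α ≤ β) (hl : 0 < l) (hl1 : l < 1)
    {ψ : ℝ → ℝ} (hm : Measurable ψ) (hb : ∀ x, |ψ x| ≤ 1) (hp : Function.Periodic ψ 1) :
    ((1 - (1 - l) ^ 2) * α + (1 - l) ^ 2 * β) / 2 ≤ spinEnergy α β l ψ := by
  rw [spinEnergy_eq hl hl1 hm hb hp]
  have := mul_le_mul_of_nonneg_left (integral_mul_window_le hm hb hp hl hl1) (sub_nonneg.2 hαβ)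
  -- The `s²` terms combine to `α s² / 2 ≥ 0`, which is why the bound holds for every mean.
  nlinarith [mul_nonneg hα (sq_nonneg (∫ x in (0 : ℝ)..1, ψ x))]

theorem spinEnergy_congr_ae {ψ ψ' : ℝ → ℝ} (h : ψ =ᵐ[unitMeasure] ψ') :
    spinEnergy α β l ψ = spinEnergy α β l ψ' := by
  unfold spinEnergy
  simp only [intervalIntegral.integral_of_le zero_le_one, integral_Ioc_eq_integral_Ioo]
  refine integral_congr_ae ?_
  filter_upwards [h] with x hx
  refine integral_congr_ae ?_
  filter_upwards [h] with y hy
  simp only [hx, hy]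

theorem le_spinEnergy (hα : 0 ≤ α) (hαβ : α ≤ β) (hl : 0 < l) (hl1 : l < 1)
    {ψ : ℝ → ℝ} (hm : AEMeasurable ψ unitMeasure) (hb : ∀ᵐ x ∂unitMeasure, |ψ x| ≤ 1) :
    ((1 - (1 - l) ^ 2) * α + (1 - l) ^ 2 * β) / 2 ≤ spinEnergy α β l ψ := by
  -- A measurable representative, truncated to `[-1, 1]` and extended periodically; the energy sees
  -- only its values on the cell.
  set η : ℝ → ℝ := fun x => max (-1) (min 1 (hm.mk ψ (Int.fract x))) with hη
  have h : ψ =ᵐ[unitMeasure] η := by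
    filter_upwards [hm.ae_eq_mk, hb, ae_restrict_mem measurableSet_Ioo] with x h1 h2 h3
    rw [hη]
    dsimp only
    rw [Int.fract_eq_self.2 ⟨h3.1.le, h3.2⟩, ← h1, min_eq_right (abs_le.1 h2).2,
      max_eq_right (abs_le.1 h2).1]
  rw [spinEnergy_congr_ae h]
  refine le_spinEnergy_of_periodic hα hαβ hl hl1
    (measurable_const.max (measurable_const.min (hm.measurable_mk.comp measurable_fract)))
    (fun x => abs_le.2 ⟨le_max_left _ _, max_le (by norm_num) (min_le_left _ _)⟩) fun x => ?_
  simp [hη]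

theorem cellEnergy_eq_spinEnergy (α β l : ℝ) (φ : ℝ → ℝ) :
    cellEnergy α β l φ = spinEnergy α β l fun x => 2 * φ x - 1 := by
  unfold spinEnergy cellEnergy
  simp only [intervalIntegral.integral_of_le zero_le_one, integral_Ioc_eq_integral_Ioo]
  refine integral_congr_ae (Eventually.of_forall fun x => ?_)
  refine integral_congr_ae (Eventually.of_forall fun y => ?_)
  dsimp only
  ring

theorem le_cellEnergy (hα : 0 ≤ α) (hαβ : α ≤ β) (hl : 0 < l) (hl1 : l < 1) {t : ℝ}
    {φ : ℝ → ℝ} (hφ : φ ∈ cellProfiles t) :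
    ((1 - (1 - l) ^ 2) * α + (1 - l) ^ 2 * β) / 2 ≤ cellEnergy α β l φ := by
  rw [cellEnergy_eq_spinEnergy]
  refine le_spinEnergy hα hαβ hl hl1 ((hφ.1.const_mul 2).sub_const 1) ?_
  filter_upwards [hφ.2.1] with x hx
  rw [abs_le]
  constructor <;> linarith [hx.1, hx.2]

end Band

/-! ### The optimal profile. -/

/-- The square wave `2 φ_{1/2} - 1`. -/
noncomputable def squareWave (x : ℝ) : ℝ := 2 * bandProfile (1 / 2) x - 1

theorem measurable_squareWave : Measurable squareWave :=
  ((measurable_bandProfile _).const_mul 2).sub_const 1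

theorem squareWave_eq_or (x : ℝ) : squareWave x = 1 ∨ squareWave x = -1 := by
  unfold squareWave bandProfile
  split_ifs <;> norm_num

theorem abs_squareWave_le (x : ℝ) : |squareWave x| ≤ 1 := by
  rcases squareWave_eq_or x with h | h <;> rw [h] <;> norm_num

theorem squareWave_periodic : Function.Periodic squareWave 1 := fun x => by
  simp [squareWave, bandProfile]

theorem squareWave_of_mem_inner {x : ℝ} (h1 : -(1 / 4) < x) (h2 : x < 1 / 4) :
    squareWave x = 1 := by
  have : bandProfile (1 / 2) x = 1 := by
    refine if_pos ?_
    rcases le_or_gt 0 x with h | h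
    · left
      rw [Int.fract_eq_self.2 ⟨h, by linarith⟩]
      linarith
    · right
      rw [← Int.fract_add_one, Int.fract_eq_self.2 ⟨by linarith, by linarith⟩]
      linarith
  rw [squareWave, this]
  norm_num

theorem squareWave_of_mem_outer {x : ℝ} (h1 : 1 / 4 < x) (h2 : x < 3 / 4) :
    squareWave x = -1 := by
  have : bandProfile (1 / 2) x = 0 := by
    refine if_neg ?_
    rw [Int.fract_eq_self.2 ⟨by linarith, by linarith⟩]
    rintro (h | h) <;> linarith
  rw [squareWave, this]
  norm_num

/-- The excluded points are the jumps `1/4 + ℤ/2`: the wave takes the value `-1` at all of them, so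
the antisymmetry fails there. -/
theorem squareWave_add_half {x : ℝ} (hx : ∀ n : ℤ, x ≠ 1 / 4 + n / 2) :
    squareWave (x + 1 / 2) = -squareWave x := by
  have key : ∀ y : ℝ, -(1 / 4) ≤ y → y < 3 / 4 → y ≠ -(1 / 4) → y ≠ 1 / 4 →
      squareWave (y + 1 / 2) = -squareWave y := by
    intro y h1 h2 h3 h4
    have h1' := lt_of_le_of_ne h1 h3.symm
    rcases lt_or_gt_of_ne h4 with h | h
    · rw [squareWave_of_mem_inner h1' h, squareWave_of_mem_outer (by linarith) (by linarith)]
    · rw [squareWave_of_mem_outer h h2, ← squareWave_periodic.sub_eq,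
        squareWave_of_mem_inner (by linarith) (by linarith), neg_neg]
  set n := ⌊x + 1 / 4⌋ with hn
  have h1 := Int.floor_le (x + 1 / 4)
  have h2 := Int.lt_floor_add_one (x + 1 / 4)
  rw [← hn] at h1 h2
  have e := key (x - n) (by linarith) (by linarith)
    (fun h => hx (2 * n - 1) (by push_cast; linarith))
    (fun h => hx (2 * n) (by push_cast; linarith))
  rwa [show x - (n : ℝ) + 1 / 2 = x + 1 / 2 - n * 1 by ring, show x - (n : ℝ) = x - n * 1 by ring,
    squareWave_periodic.sub_int_mul_eq, squareWave_periodic.sub_int_mul_eq] at e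

theorem intervalIntegrable_squareWave (a b : ℝ) : IntervalIntegrable squareWave volume a b :=
  intervalIntegrable_of_abs_le measurable_squareWave abs_squareWave_le a b

theorem integral_squareWave_inner {a b : ℝ} (hab : a ≤ b) (h1 : -(1 / 4) ≤ a) (h2 : b ≤ 1 / 4) :
    ∫ x in a..b, squareWave x = b - a := by
  rw [integral_congr_of_eqOn_Ioo (g := fun _ => (1 : ℝ)) hab fun x hx =>
    squareWave_of_mem_inner (by linarith [hx.1]) (by linarith [hx.2])]
  simp

theorem integral_squareWave_outer {a b : ℝ} (hab : a ≤ b) (h1 : 1 / 4 ≤ a) (h2 : b ≤ 3 / 4) :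
    ∫ x in a..b, squareWave x = -(b - a) := by
  rw [integral_congr_of_eqOn_Ioo (g := fun _ => (-1 : ℝ)) hab fun x hx =>
    squareWave_of_mem_outer (by linarith [hx.1]) (by linarith [hx.2])]
  simp

theorem integral_squareWave : ∫ x in (0 : ℝ)..1, squareWave x = 0 := by
  have h := squareWave_periodic.intervalIntegral_add_eq 0 (-(1 / 4))
  rw [zero_add, ← intervalIntegral.integral_add_adjacent_intervals
    (intervalIntegrable_squareWave (-(1 / 4)) (1 / 4)) (intervalIntegrable_squareWave _ _),
    integral_squareWave_inner (by norm_num) le_rfl le_rfl,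
    integral_squareWave_outer (by norm_num) le_rfl (by norm_num)] at h
  rw [h]
  norm_num

theorem integral_squareWave_shift {r : ℝ} (hr : |r| ≤ 1 / 2) :
    ∫ x in (-(1 / 4) : ℝ)..(1 / 4), squareWave (x + r) = 1 / 2 - 2 * |r| := by
  have hI := intervalIntegrable_squareWave
  rw [intervalIntegral.integral_comp_add_right squareWave]
  rcases le_total 0 r with h | h
  · rw [abs_of_nonneg h] at hr ⊢
    rw [← intervalIntegral.integral_add_adjacent_intervals (hI (-(1 / 4) + r) (1 / 4)) (hI _ _),
      integral_squareWave_inner (by linarith) (by linarith) le_rfl,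
      integral_squareWave_outer (by linarith) le_rfl (by linarith)]
    ring
  · rw [abs_of_nonpos h] at hr ⊢
    have e : ∫ x in (-(1 / 4) + r)..(-(1 / 4)), squareWave x = r := by
      have := intervalIntegral.integral_comp_add_right (a := -(1 / 4) + r) (b := -(1 / 4))
        squareWave 1
      simp only [squareWave_periodic _] at this
      rw [this, integral_squareWave_outer (by linarith) (by linarith) (by norm_num)]
      ring
    rw [← intervalIntegral.integral_add_adjacent_intervals (hI (-(1 / 4) + r) (-(1 / 4))) (hI _ _),
      e, integral_squareWave_inner (by linarith) le_rfl (by linarith)]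
    ring

theorem integral_half_sub_abs {l : ℝ} (hl : 0 ≤ l) :
    ∫ r in (-(l / 2))..(l / 2), (1 / 2 - 2 * |r|) = l * (1 - l) / 2 := by
  have hc : Continuous fun r : ℝ => 1 / 2 - 2 * |r| := by fun_prop
  rw [← intervalIntegral.integral_add_adjacent_intervals (hc.intervalIntegrable _ 0)
    (hc.intervalIntegrable _ _),
    integral_congr_of_eqOn_Ioo (g := fun r => 1 / 2 - 2 * -r) (by linarith) fun r hr => by
      rw [abs_of_neg hr.2],
    integral_congr_of_eqOn_Ioo (a := 0) (g := fun r => 1 / 2 - 2 * r) (by linarith) fun r hr => by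
      rw [abs_of_pos hr.1]]
  rw [intervalIntegral.integral_sub (by simp) ((by fun_prop : Continuous fun r : ℝ =>
      2 * -r).intervalIntegrable _ _), intervalIntegral.integral_sub (by simp)
    ((by fun_prop : Continuous fun r : ℝ => 2 * r).intervalIntegrable _ _),
    intervalIntegral.integral_const_mul, intervalIntegral.integral_const_mul,
    intervalIntegral.integral_neg]
  simp only [integral_id, intervalIntegral.integral_const, smul_eq_mul]
  ring

theorem intervalIntegral_swap_of_abs_le {f : ℝ → ℝ → ℝ} {a b c d C : ℝ} (hab : a ≤ b)
    (hcd : c ≤ d) (hf : Measurable fun p : ℝ × ℝ => f p.1 p.2) (hC : ∀ p : ℝ × ℝ, |f p.1 p.2| ≤ C) :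
    ∫ x in a..b, ∫ y in c..d, f x y = ∫ y in c..d, ∫ x in a..b, f x y := by
  simp only [intervalIntegral.integral_of_le hab, intervalIntegral.integral_of_le hcd]
  refine integral_integral_swap ?_
  exact Integrable.of_bound hf.aestronglyMeasurable C (Eventually.of_forall hC)

/-- Since `P` has mean zero, its integrals over the half periods where the wave is `1` and `-1` are
opposite. The correlation is therefore twice the integral of `P` over `[-1/4, 1/4]`, and Fubini
reduces that to the overlap `1 / 2 - 2 |r|` of the wave with its shifts. -/
theorem integral_squareWave_mul_window {l : ℝ} (hl : 0 < l) (hl1 : l < 1) :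
    ∫ x in (0 : ℝ)..1, squareWave x * ∫ t in (x - l / 2)..(x + l / 2), squareWave t
      = l * (1 - l) := by
  have hPc := continuous_integral_window measurable_squareWave abs_squareWave_le l
  have hPI := integral_integral_window measurable_squareWave abs_squareWave_le
    squareWave_periodic l
  rw [integral_squareWave, mul_zero] at hPI
  have hP1 : Function.Periodic (fun x => ∫ t in (x - l / 2)..(x + l / 2), squareWave t) 1 := by
    intro x
    have := intervalIntegral.integral_comp_add_right (a := x - l / 2) (b := x + l / 2) squareWave 1
    simp only [squareWave_periodic _] at this
    dsimp only
    rw [this]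
    congr 1 <;> ring
  have hswap : ∫ x in (-(1 / 4) : ℝ)..(1 / 4), ∫ t in (x - l / 2)..(x + l / 2), squareWave t
      = l * (1 - l) / 2 := by
    have e : ∀ x, ∫ t in (x - l / 2)..(x + l / 2), squareWave t
        = ∫ r in (-(l / 2))..(l / 2), squareWave (x + r) := fun x => by
      rw [intervalIntegral.integral_comp_add_left squareWave, ← sub_eq_add_neg]
    simp only [e]
    rw [intervalIntegral_swap_of_abs_le (C := 1) (by norm_num) (by linarith)
      (measurable_squareWave.comp measurable_add) fun p => abs_squareWave_le _]
    rw [← integral_half_sub_abs hl.le]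
    refine integral_congr_of_eqOn_Ioo (by linarith) fun r hr => ?_
    exact integral_squareWave_shift (abs_le.2 ⟨by linarith [hr.1], by linarith [hr.2]⟩)
  set P : ℝ → ℝ := fun x => ∫ t in (x - l / 2)..(x + l / 2), squareWave t with hP
  have hI : ∀ a b, IntervalIntegrable P volume a b := fun a b => hPc.intervalIntegrable a b
  have hψP := intervalIntegrable_mul_of_abs_le measurable_squareWave abs_squareWave_le hPc
  have hper : Function.Periodic (fun x => squareWave x * P x) 1 := fun x => by
    simp only [squareWave_periodic x, hP1 x]
  have h1 := hper.intervalIntegral_add_eq 0 (-(1 / 4))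
  have h2 := hP1.intervalIntegral_add_eq 0 (-(1 / 4))
  rw [zero_add, hPI, ← intervalIntegral.integral_add_adjacent_intervals (hI _ (1 / 4)) (hI _ _),
    hswap] at h2
  rw [zero_add, ← intervalIntegral.integral_add_adjacent_intervals (hψP (-(1 / 4)) (1 / 4))
      (hψP _ _),
    integral_congr_of_eqOn_Ioo (a := -(1 / 4)) (b := 1 / 4) (g := P) (by norm_num) fun x hx => by
      rw [squareWave_of_mem_inner hx.1 hx.2, one_mul],
    integral_congr_of_eqOn_Ioo (a := 1 / 4) (b := -(1 / 4) + 1) (g := fun x => -P x)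
      (by norm_num) fun x hx => by
      rw [squareWave_of_mem_outer hx.1 (by linarith [hx.2]), neg_one_mul],
    intervalIntegral.integral_neg, hswap] at h1
  rw [h1]
  linarith

theorem spinEnergy_squareWave {α β l : ℝ} (hl : 0 < l) (hl1 : l < 1) :
    spinEnergy α β l squareWave = ((1 - (1 - l) ^ 2) * α + (1 - l) ^ 2 * β) / 2 := by
  rw [spinEnergy_eq hl hl1 measurable_squareWave abs_squareWave_le squareWave_periodic,
    integral_squareWave, integral_squareWave_mul_window hl hl1]
  ring

theorem cellEnergy_bandProfile {α β l : ℝ} (hl : 0 < l) (hl1 : l < 1) :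
    cellEnergy α β l (bandProfile (1 / 2)) = ((1 - (1 - l) ^ 2) * α + (1 - l) ^ 2 * β) / 2 := by
  rw [cellEnergy_eq_spinEnergy, ← spinEnergy_squareWave hl hl1]
  rfl

theorem bandProfile_mem_cellProfiles : bandProfile (1 / 2) ∈ cellProfiles (1 / 2) := by
  refine ⟨(measurable_bandProfile _).aemeasurable, Eventually.of_forall fun x => ?_, ?_⟩
  · unfold bandProfile
    split_ifs <;> simp
  · have h := integral_squareWave
    have e : ∀ x, bandProfile (1 / 2) x = 1 / 2 + 1 / 2 * squareWave x := fun x => by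
      unfold squareWave
      ring
    rw [← integral_Ioc_eq_integral_Ioo, ← intervalIntegral.integral_of_le zero_le_one]
    simp only [e]
    rw [intervalIntegral.integral_add (by simp)
      ((intervalIntegrable_squareWave _ _).const_mul _), intervalIntegral.integral_const_mul, h]
    norm_num

/-! ### Folding many periods onto the unit cell. -/

section Folding

theorem integral_fold {h : ℝ → ℝ} (hI : ∀ a b, IntervalIntegrable h volume a b) (ε : ℝ) (N : ℕ) :
    ∫ x in (0 : ℝ)..(ε * N), h x
      = ∑ i ∈ Finset.range N, ε * ∫ σ in (0 : ℝ)..1, h (ε * σ + ε * i) := by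
  have := intervalIntegral.sum_integral_adjacent_intervals (f := h) (μ := volume)
    (a := fun k : ℕ => ε * k) (n := N) fun k _ => hI _ _
  simp only [Nat.cast_zero, mul_zero] at this
  rw [← this]
  refine Finset.sum_congr rfl fun i _ => ?_
  rw [intervalIntegral.mul_integral_comp_mul_add]
  congr 1
  · ring
  · push_cast
    ring

theorem measurable_intervalIntegral_right {K : ℝ → ℝ → ℝ}
    (hK : Measurable fun p : ℝ × ℝ => K p.1 p.2) (a b : ℝ) :
    Measurable fun x => ∫ y in a..b, K x y := by
  simp only [intervalIntegral]
  exact (hK.stronglyMeasurable.integral_prod_right'.sub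
    hK.stronglyMeasurable.integral_prod_right').measurable

theorem intervalIntegrable_intervalIntegral {K : ℝ → ℝ → ℝ} {C : ℝ}
    (hK : Measurable fun p : ℝ × ℝ => K p.1 p.2) (hC : ∀ x y, |K x y| ≤ C) (a b u v : ℝ) :
    IntervalIntegrable (fun x => ∫ y in a..b, K x y) volume u v :=
  intervalIntegrable_of_abs_le (measurable_intervalIntegral_right hK a b)
    (fun x => intervalIntegral.norm_integral_le_of_norm_le_const (f := K x) (C := C)
      fun y _ => hC x y) u v

variable {α β l ε : ℝ} {ψ : ℝ → ℝ}

/-- The energy density in the variables `ψ = 2 φ - 1`. -/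
noncomputable def spinDensity (α β l ε : ℝ) (ψ : ℝ → ℝ) (x y : ℝ) : ℝ :=
  bandWeight α β l ((x - y) / ε) * ((1 + ψ x * ψ y) / 2)

theorem half_one_add_mul_mem_Icc (hb : ∀ x, |ψ x| ≤ 1) (x y : ℝ) :
    (1 + ψ x * ψ y) / 2 ∈ Icc (0 : ℝ) 1 := by
  have h := abs_le.1 ((abs_mul (ψ x) (ψ y)).trans_le
    (mul_le_one₀ (hb x) (abs_nonneg _) (hb y)))
  constructor <;> linarith [h.1, h.2]

theorem measurable_spinDensity (hm : Measurable ψ) :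
    Measurable fun p : ℝ × ℝ => spinDensity α β l ε ψ p.1 p.2 := by
  unfold spinDensity
  have := measurable_bandWeight α β l
  fun_prop

theorem spinDensity_mem_Icc (hα : 0 ≤ α) (hαβ : α ≤ β) (hb : ∀ x, |ψ x| ≤ 1) (x y : ℝ) :
    spinDensity α β l ε ψ x y ∈ Icc 0 β := by
  have h := bandWeight_mem_Icc (l := l) hαβ ((x - y) / ε)
  have h' := half_one_add_mul_mem_Icc hb x y
  refine ⟨mul_nonneg (hα.trans h.1) h'.1, ?_⟩
  exact (mul_le_of_le_one_right (hα.trans h.1) h'.2).trans h.2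

theorem abs_spinDensity_le (hα : 0 ≤ α) (hαβ : α ≤ β) (hb : ∀ x, |ψ x| ≤ 1) (x y : ℝ) :
    |spinDensity α β l ε ψ x y| ≤ β := by
  have h := spinDensity_mem_Icc (l := l) (ε := ε) hα hαβ hb x y
  rw [abs_of_nonneg h.1]
  exact h.2

/-- Folding a square that consists of `N × N` periods onto the unit cell. -/
theorem integral_spinDensity_fold (hα : 0 ≤ α) (hαβ : α ≤ β) (hε : ε ≠ 0) (hm : Measurable ψ)
    (hb : ∀ x, |ψ x| ≤ 1) {N : ℕ} (hN : N ≠ 0) :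
    ∫ x in (0 : ℝ)..(ε * N), ∫ y in (0 : ℝ)..(ε * N), spinDensity α β l ε ψ x y
      = (ε * N) ^ 2 *
        spinEnergy α β l fun σ => (∑ i ∈ Finset.range N, ψ (ε * σ + ε * i)) / N := by
  have hw := measurable_bandWeight α β l
  have hK := measurable_spinDensity (α := α) (β := β) (l := l) (ε := ε) hm
  have hKb := abs_spinDensity_le (l := l) (ε := ε) hα hαβ hb
  have hper : ∀ t (i j : ℕ), bandWeight α β l (t + i - j) = bandWeight α β l t := fun t i j => by
    have h1 := (bandWeight_periodic α β l).sub_nat_mul_eq (x := t + i) j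
    have h2 := (bandWeight_periodic α β l).nat_mul i t
    rw [mul_one] at h1 h2
    rw [h1, h2]
  have hshift : ∀ σ τ (i j : ℕ), spinDensity α β l ε ψ (ε * σ + ε * i) (ε * τ + ε * j)
      = bandWeight α β l (σ - τ) * ((1 + ψ (ε * σ + ε * i) * ψ (ε * τ + ε * j)) / 2) := by
    intro σ τ i j
    rw [spinDensity, ← hper (σ - τ) i j]
    congr 2
    field_simp
    ring
  rw [integral_fold (intervalIntegrable_intervalIntegral hK hKb 0 (ε * N))]
  have hin : ∀ x, ∫ y in (0 : ℝ)..(ε * N), spinDensity α β l ε ψ x y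
      = ∑ j ∈ Finset.range N, ε * ∫ τ in (0 : ℝ)..1, spinDensity α β l ε ψ x (ε * τ + ε * j) :=
    fun x => integral_fold (intervalIntegrable_of_abs_le
      (hK.comp (measurable_const.prodMk measurable_id)) (hKb x)) ε N
  simp only [hin, hshift]
  have hmeas : ∀ i j : ℕ, Measurable fun p : ℝ × ℝ =>
      bandWeight α β l (p.1 - p.2) * ((1 + ψ (ε * p.1 + ε * i) * ψ (ε * p.2 + ε * j)) / 2) := by
    intro i j
    fun_prop
  have hbd : ∀ (i j : ℕ) x y, |bandWeight α β l (x - y) *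
      ((1 + ψ (ε * x + ε * i) * ψ (ε * y + ε * j)) / 2)| ≤ β := by
    intro i j x y
    rw [← hshift]
    exact hKb _ _
  have hii : ∀ (i j : ℕ), IntervalIntegrable (fun σ => ε * ∫ τ in (0 : ℝ)..1,
      bandWeight α β l (σ - τ) * ((1 + ψ (ε * σ + ε * i) * ψ (ε * τ + ε * j)) / 2)) volume 0 1 :=
    fun i j => (intervalIntegrable_intervalIntegral (hmeas i j) (hbd i j) 0 1 0 1).const_mul ε
  have hij : ∀ (i j : ℕ) σ, IntervalIntegrable (fun τ =>
      bandWeight α β l (σ - τ) * ((1 + ψ (ε * σ + ε * i) * ψ (ε * τ + ε * j)) / 2)) volume 0 1 :=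
    fun i j σ => intervalIntegrable_of_abs_le
      ((hmeas i j).comp (measurable_const.prodMk measurable_id)) (hbd i j σ) 0 1
  have hsi : ∀ i : ℕ, IntervalIntegrable (fun σ => ∑ j ∈ Finset.range N, ε * ∫ τ in (0 : ℝ)..1,
      bandWeight α β l (σ - τ) * ((1 + ψ (ε * σ + ε * i) * ψ (ε * τ + ε * j)) / 2))
      volume 0 1 := fun i => by
    simpa only [Finset.sum_fn] using IntervalIntegrable.sum (Finset.range N) fun j _ => hii i j
  have hsj : ∀ (i : ℕ) σ, IntervalIntegrable (fun τ => ∑ j ∈ Finset.range N,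
      bandWeight α β l (σ - τ) * ((1 + ψ (ε * σ + ε * i) * ψ (ε * τ + ε * j)) / 2))
      volume 0 1 := fun i σ => by
    simpa only [Finset.sum_fn] using IntervalIntegrable.sum (Finset.range N) fun j _ => hij i j σ
  have hN' : (N : ℝ) ≠ 0 := Nat.cast_ne_zero.2 hN
  unfold spinEnergy
  rw [← Finset.mul_sum, ← intervalIntegral.integral_finsetSum fun i _ => hsi i, ← intervalIntegral.integral_const_mul,
    ← intervalIntegral.integral_const_mul]
  refine intervalIntegral.integral_congr fun σ _ => ?_
  dsimp only
  simp only [← Finset.mul_sum]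
  simp only [← intervalIntegral.integral_finsetSum fun j _ => hij _ j σ]
  rw [← intervalIntegral.integral_finsetSum fun i _ => hsj i σ,
    ← mul_assoc, ← intervalIntegral.integral_const_mul, ← intervalIntegral.integral_const_mul]
  refine intervalIntegral.integral_congr fun τ _ => ?_
  -- The double sum over pairs of periods factorises because the density is affine in `ψ x ψ y`;
  -- only the averaged profile survives.
  have e : ∑ i ∈ Finset.range N, ∑ j ∈ Finset.range N, bandWeight α β l (σ - τ) *
      ((1 + ψ (ε * σ + ε * i) * ψ (ε * τ + ε * j)) / 2) = bandWeight α β l (σ - τ) *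
      (((N : ℝ) ^ 2 + (∑ i ∈ Finset.range N, ψ (ε * σ + ε * i)) *
        ∑ j ∈ Finset.range N, ψ (ε * τ + ε * j)) / 2) := by
    simp only [← Finset.mul_sum, ← Finset.sum_div, Finset.sum_add_distrib, Finset.sum_mul_sum]
    simp only [Finset.sum_const, Finset.card_range, nsmul_eq_mul, mul_one]
    ring
  rw [e]
  field_simp

/-- The lower integral of a bounded kernel over `(0, L)²` as an iterated integral. -/
theorem lintegral_square_eq {K : ℝ → ℝ → ℝ} {C L : ℝ} (hL : 0 ≤ L)
    (hK : Measurable fun p : ℝ × ℝ => K p.1 p.2) (hC : ∀ x y, K x y ∈ Icc 0 C) :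
    ∫⁻ p : ℝ × ℝ, ENNReal.ofReal (K p.1 p.2)
        ∂((volume.restrict (Ioo 0 L)).prod (volume.restrict (Ioo 0 L)))
      = ENNReal.ofReal (∫ x in (0 : ℝ)..L, ∫ y in (0 : ℝ)..L, K x y) := by
  have hint : Integrable (fun p : ℝ × ℝ => K p.1 p.2)
      ((volume.restrict (Ioo 0 L)).prod (volume.restrict (Ioo 0 L))) :=
    Integrable.of_bound hK.aestronglyMeasurable C (Eventually.of_forall fun p => by
      rw [Real.norm_eq_abs, abs_of_nonneg (hC _ _).1]
      exact (hC _ _).2)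
  rw [← ofReal_integral_eq_lintegral_ofReal hint (Eventually.of_forall fun p => (hC _ _).1),
    integral_prod _ hint]
  simp only [intervalIntegral.integral_of_le hL, integral_Ioc_eq_integral_Ioo]

theorem lintegral_square_mono {L L' : ℝ} (h : L ≤ L') (f : ℝ × ℝ → ℝ≥0∞) :
    ∫⁻ p, f p ∂((volume.restrict (Ioo 0 L)).prod (volume.restrict (Ioo 0 L)))
      ≤ ∫⁻ p, f p ∂((volume.restrict (Ioo 0 L')).prod (volume.restrict (Ioo 0 L'))) := by
  rw [Measure.prod_restrict, Measure.prod_restrict]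
  exact lintegral_mono_set (prod_mono (Ioo_subset_Ioo_right h) (Ioo_subset_Ioo_right h))

/-- Averages of spins take values between `-1` and `1`, so the cell bound is needed for all profiles
with `|ψ| ≤ 1`. The part of the domain outside the `N` whole periods is discarded. -/
theorem lintegral_spinDensity_ge (hα : 0 ≤ α) (hαβ : α ≤ β) (hl : 0 < l) (hl1 : l < 1)
    (hε : 0 < ε) (hm : Measurable ψ) (hb : ∀ x, |ψ x| ≤ 1) {N : ℕ} (hN : ε * N ≤ 1) :
    ENNReal.ofReal ((ε * N) ^ 2 * (((1 - (1 - l) ^ 2) * α + (1 - l) ^ 2 * β) / 2))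
      ≤ ∫⁻ p : ℝ × ℝ, ENNReal.ofReal (spinDensity α β l ε ψ p.1 p.2)
        ∂(unitMeasure.prod unitMeasure) := by
  rcases eq_or_ne N 0 with rfl | hN0
  · simp
  refine le_trans ?_ (lintegral_square_mono hN _)
  rw [lintegral_square_eq (by positivity) (measurable_spinDensity hm)
    (spinDensity_mem_Icc hα hαβ hb), integral_spinDensity_fold hα hαβ hε.ne' hm hb hN0]
  refine ENNReal.ofReal_le_ofReal (mul_le_mul_of_nonneg_left ?_ (sq_nonneg _))
  refine le_spinEnergy hα hαβ hl hl1 (by fun_prop) (Eventually.of_forall fun x => ?_)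
  have hNpos : (0 : ℝ) < N := Nat.cast_pos.2 (Nat.pos_of_ne_zero hN0)
  rw [abs_div, Nat.abs_cast, div_le_one hNpos]
  refine (Finset.abs_sum_le_sum_abs _ _).trans ?_
  refine (Finset.sum_le_sum fun i _ => hb _).trans ?_
  simp

/-- Here the domain is enlarged to whole periods; the rescaled wave is unchanged by averaging over
them. -/
theorem lintegral_spinDensity_squareWave_le (hα : 0 ≤ α) (hαβ : α ≤ β) (hl : 0 < l)
    (hl1 : l < 1) (hε : 0 < ε) {N : ℕ} (hN : 1 ≤ ε * N) :
    ∫⁻ p : ℝ × ℝ, ENNReal.ofReal (spinDensity α β l ε (fun x => squareWave (x / ε)) p.1 p.2)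
        ∂(unitMeasure.prod unitMeasure)
      ≤ ENNReal.ofReal ((ε * N) ^ 2 * (((1 - (1 - l) ^ 2) * α + (1 - l) ^ 2 * β) / 2)) := by
  have hN0 : N ≠ 0 := by
    rintro rfl
    norm_num at hN
  have hm : Measurable fun x => squareWave (x / ε) :=
    measurable_squareWave.comp (measurable_id.div_const ε)
  have hb : ∀ x, |squareWave (x / ε)| ≤ 1 := fun x => abs_squareWave_le _
  refine (lintegral_square_mono hN _).trans ?_
  rw [lintegral_square_eq (by positivity) (measurable_spinDensity hm)
    (spinDensity_mem_Icc hα hαβ hb), integral_spinDensity_fold hα hαβ hε.ne' hm hb hN0]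
  have e : (fun σ => (∑ i ∈ Finset.range N, squareWave ((ε * σ + ε * i) / ε)) / N)
      = squareWave := by
    funext σ
    have : ∀ i : ℕ, squareWave ((ε * σ + ε * i) / ε) = squareWave σ := fun i => by
      have h := squareWave_periodic.nat_mul i σ
      rw [← mul_add, mul_div_cancel_left₀ _ hε.ne', ← h, mul_one]
    simp only [this, Finset.sum_const, Finset.card_range, nsmul_eq_mul]
    exact mul_div_cancel_left₀ _ (Nat.cast_ne_zero.2 hN0)
  rw [e, spinEnergy_squareWave hl hl1]

end Folding

/-! ### Two-sided bounds for the non-local energy. -/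

instance isProbabilityMeasure_unitMeasure : IsProbabilityMeasure unitMeasure :=
  ⟨by simp [unitMeasure]⟩

section Energy

variable {α β l ε : ℝ}

theorem measurable_tripleWell : Measurable tripleWell := by
  unfold tripleWell
  refine Measurable.ite ?_ measurable_const (Measurable.ite ?_ measurable_const measurable_const)
  · exact (measurableSet_singleton (1 : ℝ)).union (measurableSet_singleton (-1 : ℝ))
  · exact measurableSet_singleton (0 : ℝ)

/-- The cosine agrees with the potential at `0` and `±1`; its addition formula is what turns the
potential into a product of spins. -/
theorem tripleWell_ge_cos (z : ℝ) :
    ENNReal.ofReal ((1 + Real.cos (Real.pi * z)) / 2) ≤ tripleWell z := by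
  unfold tripleWell
  split_ifs with h1 h2
  · rcases h1 with rfl | rfl <;> simp
  · simp [h2]
  · exact le_top

theorem tripleWell_ne_top {z : ℝ} (h : tripleWell z ≠ ⊤) : z = 0 ∨ z = 1 ∨ z = -1 := by
  unfold tripleWell at h
  split_ifs at h with h1 h2
  · exact Or.inr h1
  · exact Or.inl h2
  · exact absurd rfl h

/-- Functions of finite energy take values in a translate of `{-1, 0, 1}`. -/
theorem exists_ae_sub_mem_of_nonlocalEnergy_ne_top (hα : 0 < α) (hαβ : α ≤ β) {u : LOne}
    (h : nonlocalEnergy α β l ε u ≠ ⊤) :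
    ∃ v : ℝ, ∀ᵐ y ∂unitMeasure, v - u y = 0 ∨ v - u y = 1 ∨ v - u y = -1 := by
  have hu : Measurable (u : ℝ → ℝ) := (Lp.stronglyMeasurable u).measurable
  have hmeas : Measurable fun p : ℝ × ℝ =>
      ENNReal.ofReal (bandWeight α β l ((p.1 - p.2) / ε)) * tripleWell (u p.1 - u p.2) := by
    have := measurable_bandWeight α β l
    have := measurable_tripleWell
    fun_prop
  have h1 := ae_lt_top hmeas h
  have h2 : ∀ᵐ p ∂(unitMeasure.prod unitMeasure),
      u p.1 - u p.2 = 0 ∨ u p.1 - u p.2 = 1 ∨ u p.1 - u p.2 = -1 := by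
    filter_upwards [h1] with p hp
    refine tripleWell_ne_top fun htop => ?_
    rw [htop, ENNReal.mul_top] at hp
    · exact lt_irrefl _ hp
    · have := (bandWeight_mem_Icc (l := l) hαβ ((p.1 - p.2) / ε)).1
      simpa using hα.trans_le this
  -- By Fubini, almost every slice is good; `v` is the value of `u` at one such point.
  obtain ⟨x, hx⟩ := (Measure.ae_ae_of_ae_prod h2).exists
  exact ⟨u x, hx⟩

theorem nonlocalEnergy_ge (hα : 0 < α) (hαβ : α ≤ β) (hl : 0 < l) (hl1 : l < 1) (hε : 0 < ε)
    {N : ℕ} (hN : ε * N ≤ 1) (u : LOne) :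
    ENNReal.ofReal ((ε * N) ^ 2 * (((1 - (1 - l) ^ 2) * α + (1 - l) ^ 2 * β) / 2))
      ≤ nonlocalEnergy α β l ε u := by
  by_cases htop : nonlocalEnergy α β l ε u = ⊤
  · rw [htop]
    exact le_top
  obtain ⟨v, hv⟩ := exists_ae_sub_mem_of_nonlocalEnergy_ne_top hα hαβ htop
  have hu : Measurable (u : ℝ → ℝ) := (Lp.stronglyMeasurable u).measurable
  have hm : Measurable fun x => Real.cos (Real.pi * (v - u x)) := by fun_prop
  refine (lintegral_spinDensity_ge hα.le hαβ hl hl1 hε hm (fun x => Real.abs_cos_le_one _)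
    hN).trans ?_
  refine lintegral_mono_ae ?_
  -- `v - u x` is an integer, so the sine term of the addition formula drops out. Differences `±2`
  -- may still occur between two points, but there the potential is infinite.
  have hsin : ∀ᵐ x ∂unitMeasure, Real.sin (Real.pi * (v - u x)) = 0 := by
    filter_upwards [hv] with x hx
    rcases hx with h | h | h <;> simp [h]
  filter_upwards [Measure.quasiMeasurePreserving_fst.ae hsin] with p hp
  rw [spinDensity, ENNReal.ofReal_mul
    (hα.le.trans (bandWeight_mem_Icc (l := l) hαβ ((p.1 - p.2) / ε)).1)]
  gcongr
  have e : Real.cos (Real.pi * (u p.1 - u p.2))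
      = Real.cos (Real.pi * (v - u p.1)) * Real.cos (Real.pi * (v - u p.2)) := by
    rw [show Real.pi * (u p.1 - u p.2) = Real.pi * (v - u p.2) - Real.pi * (v - u p.1) by ring,
      Real.cos_sub, hp]
    ring
  rw [← e]
  exact tripleWell_ge_cos _

theorem nonlocalEnergy_oscillatingLOne_le (hα : 0 ≤ α) (hαβ : α ≤ β) (hl : 0 < l) (hl1 : l < 1)
    (hε : 0 < ε) {N : ℕ} (hN : 1 ≤ ε * N) (c : ℝ) :
    nonlocalEnergy α β l ε (oscillatingLOne c ε)
      ≤ ENNReal.ofReal ((ε * N) ^ 2 * (((1 - (1 - l) ^ 2) * α + (1 - l) ^ 2 * β) / 2)) := by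
  refine le_trans (le_of_eq ?_) (lintegral_spinDensity_squareWave_le hα hαβ hl hl1 hε hN)
  have h := (memLp_oscillation c ε).coeFn_toLp
  refine lintegral_congr_ae ?_
  filter_upwards [Measure.quasiMeasurePreserving_fst.ae h,
    Measure.quasiMeasurePreserving_snd.ae h] with p h1 h2
  rw [oscillatingLOne, h1, h2, spinDensity, ENNReal.ofReal_mul
    (hα.trans (bandWeight_mem_Icc (l := l) hαβ ((p.1 - p.2) / ε)).1)]
  congr 1
  have e : ∀ x, c - 1 / 2 + bandProfile (1 / 2) x = c + squareWave x / 2 := fun x => by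
    unfold squareWave
    ring
  rw [e, e]
  unfold tripleWell
  rcases squareWave_eq_or (p.1 / ε) with h1 | h1 <;>
    rcases squareWave_eq_or (p.2 / ε) with h2 | h2 <;> rw [h1, h2] <;> norm_num

theorem tendsto_mul_floor : Tendsto (fun ε : ℝ => ε * ⌊1 / ε⌋₊) (𝓝[>] 0) (𝓝 1) := by
  have h := (tendsto_nat_floor_div_atTop (R := ℝ)).comp tendsto_inv_nhdsGT_zero
  refine h.congr fun ε => ?_
  simp [div_eq_mul_inv, mul_comm]

theorem mul_floor_le (hε : 0 < ε) : ε * ⌊1 / ε⌋₊ ≤ 1 := by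
  have := Nat.floor_le (one_div_nonneg.2 hε.le)
  rwa [le_div_iff₀ hε, mul_comm] at this

theorem le_mul_floor_add_one (hε : 0 < ε) : 1 ≤ ε * (⌊1 / ε⌋₊ + 1 : ℕ) := by
  have := (Nat.lt_floor_add_one (1 / ε)).le
  rw [div_le_iff₀ hε, mul_comm] at this
  exact_mod_cast this

theorem tendsto_mul_floor_add_one :
    Tendsto (fun ε : ℝ => ε * (⌊1 / ε⌋₊ + 1 : ℕ)) (𝓝[>] 0) (𝓝 1) := by
  have h : Tendsto (fun ε : ℝ => ε) (𝓝[>] 0) (𝓝 0) := tendsto_id.mono_left nhdsWithin_le_nhds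
  have := tendsto_mul_floor.add h
  rw [add_zero] at this
  refine this.congr fun ε => ?_
  push_cast
  ring

theorem tendsto_ofReal_sq_mul {f : ℝ → ℝ} (hf : Tendsto f (𝓝[>] 0) (𝓝 1)) (M : ℝ) :
    Tendsto (fun ε => ENNReal.ofReal (f ε ^ 2 * M)) (𝓝[>] 0) (𝓝 (ENNReal.ofReal M)) := by
  have := ENNReal.tendsto_ofReal ((hf.pow 2).mul_const M)
  rwa [one_pow, one_mul] at this

theorem tendsto_nonlocalEnergy_oscillatingLOne (hα : 0 < α) (hαβ : α ≤ β) (hl : 0 < l)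
    (hl1 : l < 1) (c : ℝ) :
    Tendsto (fun ε => nonlocalEnergy α β l ε (oscillatingLOne c ε)) (𝓝[>] 0)
      (𝓝 (ENNReal.ofReal (((1 - (1 - l) ^ 2) * α + (1 - l) ^ 2 * β) / 2))) := by
  refine tendsto_of_tendsto_of_tendsto_of_le_of_le' (tendsto_ofReal_sq_mul tendsto_mul_floor _)
    (tendsto_ofReal_sq_mul tendsto_mul_floor_add_one _) ?_ ?_
  · filter_upwards [self_mem_nhdsWithin] with ε hε
    exact nonlocalEnergy_ge hα hαβ hl hl1 hε (mul_floor_le hε) _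
  · filter_upwards [self_mem_nhdsWithin] with ε hε
    exact nonlocalEnergy_oscillatingLOne_le hα.le hαβ hl hl1 hε (le_mul_floor_add_one hε) c

end Energy

/-! ### Weak convergence of the oscillating functions. -/

section WeakConvergence

/-- A continuous functional on `L¹` is represented on `L²` by a square-integrable function. -/
theorem exists_integral_repr (T : LOne →L[ℝ] ℝ) :
    ∃ g : ℝ → ℝ, Integrable g unitMeasure ∧ ∀ (f : ℝ → ℝ) (hf1 : MemLp f 1 unitMeasure),
      MemLp f 2 unitMeasure → T (hf1.toLp f) = ∫ x, g x * f x ∂unitMeasure := by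
  have hmem : ∀ v : Lp ℝ 2 unitMeasure, MemLp v 1 unitMeasure := fun v =>
    (Lp.memLp v).mono_exponent (by norm_num)
  let J : Lp ℝ 2 unitMeasure →ₗ[ℝ] LOne :=
    { toFun := fun v => (hmem v).toLp v
      map_add' := fun v w => by
        rw [← MemLp.toLp_add]
        exact MemLp.toLp_congr _ _ (Lp.coeFn_add v w)
      map_smul' := fun r v => by
        rw [RingHom.id_apply, ← MemLp.toLp_const_smul]
        exact MemLp.toLp_congr _ _ (Lp.coeFn_smul r v) }
  let Jc : Lp ℝ 2 unitMeasure →L[ℝ] LOne := J.mkContinuous 1 fun v => by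
    change ‖(hmem v).toLp v‖ ≤ 1 * ‖v‖
    rw [Lp.norm_toLp, one_mul, Lp.norm_def]
    exact ENNReal.toReal_mono (Lp.eLpNorm_ne_top v)
      (eLpNorm_le_eLpNorm_of_exponent_le (by norm_num) (Lp.aestronglyMeasurable v))
  -- Riesz representation of the restriction to `L²`; the test functions are bounded, so this
  -- representation is enough.
  let g := (InnerProductSpace.toDual ℝ (Lp ℝ 2 unitMeasure)).symm (T ∘L Jc)
  refine ⟨g, (hmem g).integrable le_rfl, fun f hf1 hf2 => ?_⟩
  have h1 : T (Jc (hf2.toLp f)) = inner ℝ g (hf2.toLp f) :=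
    (InnerProductSpace.toDual_symm_apply (x := hf2.toLp f) (y := T ∘L Jc)).symm
  have h2 : Jc (hf2.toLp f) = hf1.toLp f :=
    MemLp.toLp_congr (hmem (hf2.toLp f)) hf1 hf2.coeFn_toLp
  rw [← h2, h1, L2.inner_def]
  refine integral_congr_ae ?_
  filter_upwards [hf2.coeFn_toLp] with x hx
  rw [hx]
  simp [mul_comm]

/-- Continuity of translations in `L¹`. -/
theorem tendsto_integral_norm_translate_sub {G : ℝ → ℝ} (hG : Integrable G) :
    Tendsto (fun h : ℝ => ∫ x, ‖G (x + h) - G x‖) (𝓝 0) (𝓝 0) := by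
  have hm : MemLp G 1 volume := memLp_one_iff_integrable.2 hG
  have : Fact ((1 : ℝ≥0∞) ≠ ⊤) := ⟨ENNReal.one_ne_top⟩
  have hc : Continuous fun h : ℝ => (DomAddAct.mk h +ᵥ hm.toLp G : Lp ℝ 1 volume) :=
    DomAddAct.continuous_mk.vadd continuous_const
  have h1 := (hc.tendsto 0).dist (tendsto_const_nhds (x := hm.toLp G))
  have h2 : (DomAddAct.mk (0 : ℝ) +ᵥ hm.toLp G : Lp ℝ 1 volume) = hm.toLp G := by
    rw [DomAddAct.mk_vadd_toLp]
    exact MemLp.toLp_congr _ _ (Eventually.of_forall fun x => by simp)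
  rw [h2, dist_self] at h1
  refine h1.congr fun h => ?_
  rw [L1.dist_eq_integral_dist]
  refine integral_congr_ae ?_
  have h3 : (DomAddAct.mk h +ᵥ hm.toLp G : Lp ℝ 1 volume) =ᵐ[volume] fun x => G (h +ᵥ x) := by
    rw [DomAddAct.mk_vadd_toLp]
    exact MemLp.coeFn_toLp _
  filter_upwards [h3, hm.coeFn_toLp] with x h4 h5
  rw [h4, h5, vadd_eq_add, add_comm, Real.dist_eq, Real.norm_eq_abs]

/-- Shifting by the half period `ε / 2` changes the sign of the wave, so twice the integral is
bounded by the `L¹` distance between `G` and its shift. -/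
theorem tendsto_integral_mul_squareWave {G : ℝ → ℝ} (hG : Integrable G) :
    Tendsto (fun ε : ℝ => ∫ x, G x * squareWave (x / ε)) (𝓝[>] 0) (𝓝 0) := by
  have h0 : Tendsto (fun ε : ℝ => ε / 2) (𝓝[>] 0) (𝓝 0) := by
    have : Tendsto (fun ε : ℝ => ε / 2) (𝓝 0) (𝓝 (0 / 2)) := tendsto_id.div_const 2
    rw [zero_div] at this
    exact this.mono_left nhdsWithin_le_nhds
  refine squeeze_zero_norm' ?_ ((tendsto_integral_norm_translate_sub hG).comp h0)
  filter_upwards [self_mem_nhdsWithin] with ε hε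
  have hε' : (0 : ℝ) < ε := hε
  have hm : Measurable fun x => squareWave (x / ε) :=
    measurable_squareWave.comp (measurable_id.div_const ε)
  have hmul : ∀ {F : ℝ → ℝ}, Integrable F → Integrable fun x => F x * squareWave (x / ε) :=
    fun hF => hF.mul_bdd (c := 1) hm.aestronglyMeasurable
      (Eventually.of_forall fun x => abs_squareWave_le _)
  have hGs : Integrable fun x => G (x + ε / 2) := hG.comp_add_right _
  have hae : ∀ᵐ x : ℝ, squareWave ((x + ε / 2) / ε) = -squareWave (x / ε) := by
    have hcount : (range fun n : ℤ => ε * (1 / 4 + n / 2)).Countable := countable_range _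
    filter_upwards [hcount.ae_notMem volume] with x hx
    rw [add_div, show ε / 2 / ε = 1 / 2 by field_simp]
    refine squareWave_add_half fun n hn => hx ⟨n, ?_⟩
    dsimp only
    rw [← hn]
    field_simp
  have h1 : ∫ x, G x * squareWave (x / ε) = -∫ x, G (x + ε / 2) * squareWave (x / ε) := by
    rw [← integral_add_right_eq_self _ (ε / 2), ← integral_neg]
    refine integral_congr_ae ?_
    filter_upwards [hae] with x hx
    rw [hx]
    ring
  have h2 : 2 * ∫ x, G x * squareWave (x / ε)
      = -∫ x, (G (x + ε / 2) - G x) * squareWave (x / ε) := by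
    simp only [sub_mul]
    rw [integral_sub (hmul hGs) (hmul hG)]
    linarith
  have h3 : ‖∫ x, (G (x + ε / 2) - G x) * squareWave (x / ε)‖ ≤ ∫ x, ‖G (x + ε / 2) - G x‖ := by
    refine norm_integral_le_of_norm_le (hGs.sub hG).norm (Eventually.of_forall fun x => ?_)
    rw [norm_mul]
    exact mul_le_of_le_one_right (norm_nonneg _) (abs_squareWave_le _)
  have h4 := congrArg norm h2
  rw [norm_mul, norm_neg, Real.norm_ofNat] at h4
  dsimp only [Function.comp]
  linarith [norm_nonneg (∫ x, G x * squareWave (x / ε))]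

theorem tendsto_oscillatingLOne (c : ℝ) :
    Tendsto (fun ε => toWeakSpace ℝ LOne (oscillatingLOne c ε)) (𝓝[>] (0 : ℝ))
      (𝓝 (toWeakSpace ℝ LOne (constLOne c))) := by
  refine (WeakBilin.tendsto_iff_forall_eval_tendsto (topDualPairing ℝ LOne).flip ?_).2 fun T => ?_
  · exact fun x y hxy => (SeparatingDual.eq_iff_forall_dual_eq (R := ℝ)).2 fun T =>
      LinearMap.congr_fun hxy T
  change Tendsto (fun ε => T (oscillatingLOne c ε)) (𝓝[>] (0 : ℝ)) (𝓝 (T (constLOne c)))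
  obtain ⟨g, hg, hT⟩ := exists_integral_repr T
  have hbd : ∀ ε, MemLp (fun x => 1 / 2 * squareWave (x / ε)) ⊤ unitMeasure := fun ε =>
    MemLp.of_bound (C := 1) ((measurable_squareWave.comp
      (measurable_id.div_const ε)).const_mul (1 / 2)).aestronglyMeasurable
      (Eventually.of_forall fun x => by
        rw [norm_mul]
        norm_num
        linarith [abs_squareWave_le (x / ε)])
  have e : ∀ ε, oscillatingLOne c ε = constLOne c
      + ((hbd ε).mono_exponent le_top : MemLp _ 1 unitMeasure).toLp _ := by
    intro ε
    rw [oscillatingLOne, constLOne, ← MemLp.toLp_const, ← MemLp.toLp_add]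
    refine MemLp.toLp_congr _ _ (Eventually.of_forall fun x => ?_)
    simp only [Pi.add_apply, squareWave]
    ring
  have hlim : Tendsto (fun ε => T (((hbd ε).mono_exponent le_top :
      MemLp _ 1 unitMeasure).toLp _)) (𝓝[>] (0 : ℝ)) (𝓝 0) := by
    have hG : Integrable ((Ioo (0 : ℝ) 1).indicator fun x => g x * (1 / 2)) :=
      (integrable_indicator_iff measurableSet_Ioo).2 (hg.mul_const _)
    refine (tendsto_integral_mul_squareWave hG).congr fun ε => ?_
    rw [hT _ _ ((hbd ε).mono_exponent le_top), ← integral_indicator measurableSet_Ioo]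
    refine integral_congr_ae (Eventually.of_forall fun x => ?_)
    by_cases hx : x ∈ Ioo (0 : ℝ) 1
    · simp only [indicator_of_mem hx]
      ring
    · simp only [indicator_of_notMem hx, zero_mul]
  simp only [e, map_add]
  simpa using hlim.const_add (T (constLOne c))

end WeakConvergence

/-! ### The homogenized energy at a constant. -/

theorem half_mem_fractionSet_constLOne (c : ℝ) : (1 / 2 : ℝ) ∈ fractionSet (constLOne c) := by
  have hc : (constLOne c : ℝ → ℝ) =ᵐ[unitMeasure] fun _ => c := Lp.coeFn_const 1 unitMeasure c
  have hE : (fun x => ((constLOne c x : ℝ) : EReal)) =ᵐ[unitMeasure] fun _ => (c : EReal) := by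
    filter_upwards [hc] with x hx
    rw [hx]
  have hint : ∫ x, constLOne c x ∂unitMeasure = c := by
    rw [integral_congr_ae hc]
    simp
  rw [fractionSet, mem_ofPred_eq, essInf_congr_ae hE, essSup_congr_ae hE, hint,
    essInf_const _ (IsProbabilityMeasure.ne_zero _),
    essSup_const _ (IsProbabilityMeasure.ne_zero _), ← EReal.coe_sub, sub_self]
  norm_cast
  norm_num

section Limits

variable {α β l : ℝ}

/-- The bound does not involve `t`, so attaining it at `t = 1/2` settles the infimum over all volume
fractions. -/
theorem le_cellValue (hα : 0 ≤ α) (hαβ : α ≤ β) (hl : 0 < l) (hl1 : l < 1) (t : ℝ) :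
    ENNReal.ofReal (((1 - (1 - l) ^ 2) * α + (1 - l) ^ 2 * β) / 2) ≤ cellValue α β l t :=
  le_iInf₂ fun _ hφ => ENNReal.ofReal_le_ofReal (le_cellEnergy hα hαβ hl hl1 hφ)

theorem cellValue_half (hα : 0 ≤ α) (hαβ : α ≤ β) (hl : 0 < l) (hl1 : l < 1) :
    cellValue α β l (1 / 2)
      = ENNReal.ofReal (((1 - (1 - l) ^ 2) * α + (1 - l) ^ 2 * β) / 2) := by
  refine le_antisymm ?_ (le_cellValue hα hαβ hl hl1 _)
  refine (iInf₂_le _ bandProfile_mem_cellProfiles).trans_eq ?_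
  rw [cellEnergy_bandProfile hl hl1]

theorem homEnergy_constLOne (hα : 0 ≤ α) (hαβ : α ≤ β) (hl : 0 < l) (hl1 : l < 1) (c : ℝ) :
    homEnergy α β l (constLOne c) = cellValue α β l (1 / 2) := by
  refine le_antisymm (iInf₂_le _ (half_mem_fractionSet_constLOne c)) (le_iInf₂ fun t _ => ?_)
  rw [cellValue_half hα hαβ hl hl1]
  exact le_cellValue hα hαβ hl hl1 t

end Limits

/-! ### From bounds to `Γ`-limits. -/

section GammaConvergence

variable {ι X : Type*} [TopologicalSpace X]

theorem gammaLiminf_le_gammaLimsup (l : Filter ι) [l.NeBot] (F : ι → X → ℝ≥0∞) (x : X) :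
    gammaLiminf l F x ≤ gammaLimsup l F x :=
  iSup₂_mono fun _ _ => liminf_le_limsup

/-- A lower bound that is uniform in `u`, together with a recovery family, determines the
`Γ`-limit. -/
theorem isGammaLimitAt_of_le_of_tendsto {l : Filter ι} [l.NeBot] {F : ι → X → ℝ≥0∞} {x : X}
    {L : ℝ≥0∞} {m : ι → ℝ≥0∞} (hm : Tendsto m l (𝓝 L)) (hmF : ∀ᶠ i in l, ∀ u, m i ≤ F i u)
    {v : ι → X} (hv : Tendsto v l (𝓝 x)) (hF : Tendsto (fun i => F i (v i)) l (𝓝 L)) :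
    IsGammaLimitAt l F x L := by
  have h1 : L ≤ gammaLiminf l F x := by
    -- As the bound is uniform in `u`, the whole space serves as the neighbourhood.
    refine le_trans ?_ (le_iSup₂ (f := fun U (_ : U ∈ 𝓝 x) =>
      liminf (fun i => ⨅ u ∈ U, F i u) l) univ univ_mem)
    rw [← hm.liminf_eq]
    refine liminf_le_liminf ?_
    filter_upwards [hmF] with i hi
    exact le_iInf₂ fun u _ => hi u
  have h2 : gammaLimsup l F x ≤ L := by
    refine iSup₂_le fun U hU => ?_
    rw [← hF.limsup_eq]
    refine limsup_le_limsup ?_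
    filter_upwards [hv hU] with i hi
    exact biInf_le (fun u => F i u) hi
  have h3 := gammaLiminf_le_gammaLimsup l F x
  exact ⟨le_antisymm (h3.trans h2) h1, le_antisymm h2 (h1.trans h3)⟩

theorem isSeqGammaLimitAt_of_le_of_tendsto {F : ℝ → X → ℝ≥0∞} {x : X} {L : ℝ≥0∞}
    {m : ℝ → ℝ≥0∞} (hm : Tendsto m (𝓝[>] 0) (𝓝 L)) (hmF : ∀ᶠ ε in 𝓝[>] 0, ∀ u, m ε ≤ F ε u)
    {v : ℝ → X} (hv : Tendsto v (𝓝[>] 0) (𝓝 x))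
    (hF : Tendsto (fun ε => F ε (v ε)) (𝓝[>] 0) (𝓝 L)) : IsSeqGammaLimitAt F x L := by
  intro e he
  refine ⟨fun u _ => ?_, v ∘ e, hv.comp he, (hF.comp he).limsup_eq.le⟩
  rw [← (hm.comp he).liminf_eq]
  refine liminf_le_liminf ?_
  filter_upwards [he.eventually hmF] with k hk
  exact hk _

end GammaConvergence

theorem theorem3p2 (α β lam : ℝ) (hα : 0 < α) (hαβ : α < β) (hlam0 : 0 < lam) (hlam1 : lam < 1)
    (c : ℝ) :
    -- the `Γ`-limit in the weak topology exists at `c` and equals the homogenized energy there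
    IsGammaLimitAt (𝓝[>] (0 : ℝ)) (fun ε => weakEnergy α β lam ε)
      (toWeakSpace ℝ LOne (constLOne c)) (homEnergy α β lam (constLOne c)) ∧
    IsSeqGammaLimitAt (fun ε => weakEnergy α β lam ε)
      (toWeakSpace ℝ LOne (constLOne c)) (homEnergy α β lam (constLOne c)) ∧
    -- the homogenized energy is a minimum over `I_c`, attained at `t = 1/2`, with explicit value
    (1 / 2 : ℝ) ∈ fractionSet (constLOne c) ∧
    homEnergy α β lam (constLOne c) = cellValue α β lam (1 / 2) ∧
    cellValue α β lam (1 / 2) =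
      ENNReal.ofReal (((1 - (1 - lam) ^ 2) * α + (1 - lam) ^ 2 * β) / 2) ∧
    -- the cell problem at `t = 1/2` has that number as its minimum, attained by `φ_{1/2}`
    IsLeast (cellEnergy α β lam '' cellProfiles (1 / 2))
      (((1 - (1 - lam) ^ 2) * α + (1 - lam) ^ 2 * β) / 2) ∧
    bandProfile (1 / 2) ∈ cellProfiles (1 / 2) ∧
    cellEnergy α β lam (bandProfile (1 / 2)) =
      ((1 - (1 - lam) ^ 2) * α + (1 - lam) ^ 2 * β) / 2 ∧
    -- the oscillating functions `c - 1/2 + φ_{1/2}(x/ε)` are a recovery family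
    Tendsto (fun ε => toWeakSpace ℝ LOne (oscillatingLOne c ε)) (𝓝[>] (0 : ℝ))
      (𝓝 (toWeakSpace ℝ LOne (constLOne c))) ∧
    Tendsto (fun ε => nonlocalEnergy α β lam ε (oscillatingLOne c ε)) (𝓝[>] (0 : ℝ))
      (𝓝 (ENNReal.ofReal (((1 - (1 - lam) ^ 2) * α + (1 - lam) ^ 2 * β) / 2))) := by
  have hm := tendsto_ofReal_sq_mul tendsto_mul_floor
    (((1 - (1 - lam) ^ 2) * α + (1 - lam) ^ 2 * β) / 2)
  have hmF : ∀ᶠ ε : ℝ in 𝓝[>] 0, ∀ u, ENNReal.ofReal ((ε * ⌊1 / ε⌋₊) ^ 2 *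
      (((1 - (1 - lam) ^ 2) * α + (1 - lam) ^ 2 * β) / 2)) ≤ weakEnergy α β lam ε u := by
    filter_upwards [self_mem_nhdsWithin] with ε hε u
    exact nonlocalEnergy_ge hα hαβ.le hlam0 hlam1 hε (mul_floor_le hε) _
  have hv := tendsto_oscillatingLOne c
  have hF := tendsto_nonlocalEnergy_oscillatingLOne hα hαβ.le hlam0 hlam1 c
  have hval := cellValue_half hα.le hαβ.le hlam0 hlam1
  have hhom := homEnergy_constLOne hα.le hαβ.le hlam0 hlam1 c
  refine ⟨?_, ?_, half_mem_fractionSet_constLOne c, hhom, hval, ⟨?_, ?_⟩,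
    bandProfile_mem_cellProfiles, cellEnergy_bandProfile hlam0 hlam1, hv, hF⟩
  · rw [hhom, hval]
    exact isGammaLimitAt_of_le_of_tendsto hm hmF hv hF
  · rw [hhom, hval]
    exact isSeqGammaLimitAt_of_le_of_tendsto hm hmF hv hF
  · exact ⟨_, bandProfile_mem_cellProfiles, cellEnergy_bandProfile hlam0 hlam1⟩
  · rintro _ ⟨φ, hφ, rfl⟩
    exact le_cellEnergy hα.le hαβ.le hlam0 hlam1 hφ
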